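/- **Setting.** Let $M$ be an oriented three-manifold with an ideal triangulation $\mathcal T=\{\mathcal T_1,\dots,\mathcal T_N\}$, i.e. $M$ is obtained from $N$ oriented tetrahedra with vertices removed by glueing their faces in pairs by orientation-reversing maps. (If the boundary of $M$ is a union of tori this is the usual setting; no assumption on the boundary is needed.) Let $\mathcal B$ be $\mathbb R$, $\mathbb C=\mathbb R+\mathbb R i$ or the algebra $\mathbb R+\mathbb R\tau$ of pseudo-complex numbers, $\tau^2=1$, with conjugation $z\mapsto\bar z$ and $|z|^2=z\bar z\in\mathbb R$. Let $\mathbb X$ be the space of real lines spanned by Hermitian $2\times2$ matrices over $\mathcal B$ of positive determinant, so $\mathbb X=\mathbb H^2,\mathbb H^3,\mathrm{AdS}^3$ respectively. The group $\mathrm{PGL}^+(2,\mathcal B)$ of matrices $A$ with $|\det A|^2>0$, up to scalars, acts on it by $X\mapsto AXA^*$. Four points $[v_a]\in\mathbb P^1\mathcal B$ determine an ideal tetrahedron if the matrices $\sum_a p_a v_av_a^*$ ($0\le p_a<1$, $\sum_a p_a=1$) represent points of $\mathbb X$. Its shape parameter at the edge $v_1v_2$ is the image $z\in\mathcal B$ of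 $[v_4]$ under the isometry that takes $[v_1],[v_2],[v_3]$ to $\infty,0,1$; one has $|z|^2,|1-z|^2>0$. The parameters at the edges are $z$ (edges $12$, $34$), $\frac1{1-z}$ (edges $13$, $24$), $\frac{z-1}z$ (edges $14$, $23$). The dihedral angle at an edge with parameter $w$ is $\arg w$ over $\mathbb C$ (used when $\operatorname{Im}w>0$). Over $\mathbb R$ and $\mathbb R+\mathbb R\tau$ it is $\pi$ or $0$ according as the real part of $w$ is negative or positive. *Thurston's equations* for $(z_j)\in\mathcal B^N$, with $|z_j|^2,|1-z_j|^2>0$, ask that around every edge of $\mathcal T$ the product of the parameters is $1$ and the total dihedral angle is $2\pi$. The set of their real solutions is the real deformation variety $\mathscr D_{\mathbb R}\subset\mathbb R^N$. A *triangulated $\mathbb X$-structure* on $(M,\mathcal T)$ is a realization of the $\mathcal T_j$ as ideal tetrahedra of $\mathbb X$, glued along their faces by elements of $\mathrm{PGL}^+(2,\mathcal B)$ whose composition around every edge is the identity, with total dihedral angle $2\pi$ around every edge. It is a *transversely hyperbolic foliation* if $\mathcal B=\mathbb R$. It is a *hyperbolic*, resp. *AdS*, *structure* if $\mathcal B=\mathbb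 C$, resp. $\mathcal B=\mathbb R+\mathbb R\tau$, and all the tetrahedra are positively oriented. Such structures $\mathscr S_t$, $t>0$, *collapse* to a foliation $\mathcal F$ as $t\to0$ if, for suitable choices of the developing maps (which are defined up to isometry), the developed ideal vertices of every tetrahedron of the universal cover converge in $\mathbb P^1\mathcal B$ to those for $\mathcal F$ (hence the developing maps converge), and the holonomies converge in $\mathrm{PGL}^+(2,\mathcal B)$ to that of $\mathcal F$. A point of $\mathscr D_{\mathbb R}$ is *smooth* if $\mathscr D_{\mathbb R}$ is an embedded real-analytic submanifold of $\mathbb R^N$ near it (for instance, if it is a nonsingular point of the variety). A *tangent vector* is the velocity at the point of a curve in $\mathscr D_{\mathbb R}$. **Proposition 5.1.** Let $(z_j)\in\mathbb R^N$ be a solution of Thurston's equations at which $\mathscr D_{\mathbb R}$ is smooth, and let $(v_j)\in\mathbb R^N$ be a tangent vector to $\mathscr D_{\mathbb R}$ at $(z_j)$ with $v_j>0$ for all $j$. Then there is a transversely hyperbolic foliation $\mathcal F$ on $(M,\mathcal T)$ with shape parameters $(z_j)$, and there are hyperbolic structures $\mathscr H_t$ and AdS structures $\mathscr A_t$ on $(M,\mathcal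 T)$, defined for $t>0$, such that $\mathscr H_t$ and $\mathscr A_t$ collapse to $\mathcal F$ (to every foliation with shape parameters $(z_j)$) as $t\to0$. More precisely, there are $C^\infty$ paths $\zeta:\mathbb R\to\mathbb C^N$ and $\xi:\mathbb R\to(\mathbb R+\mathbb R\tau)^N$ with $\zeta_j(0)=\xi_j(0)=z_j$, $\zeta_j'(0)=iv_j$ and $\xi_j'(0)=\tau v_j$ such that, for all $t>0$, $\zeta(t)$ and $\xi(t)$ solve Thurston's equations over $\mathbb C$ and $\mathbb R+\mathbb R\tau$, have all imaginary parts positive, and are the shape parameters of $\mathscr H_t$ and $\mathscr A_t$. -/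

import Mathlib

open Filter Topology
open scoped ContDiff

noncomputable section

/-! ## Oriented ideal triangulations -/

/-- An oriented topological ideal triangulation with `N` tetrahedra.  Each tetrahedron has
vertices `0, 1, 2, 3` (removed) and faces `0, 1, 2, 3`, face `f` being opposite to vertex `f`.
Face `f` of tetrahedron `j` is glued to face `perm j f f` of tetrahedron `nbr j f`, the vertex
`a ≠ f` of the face going to the vertex `perm j f a`.  The glueings reverse the orientations of
the faces, so that the orientations of the tetrahedra (given by the order of the vertices)
fit together. -/
structure IdealTriangulation (N : ℕ) where
  nbr : Fin N → Fin 4 → Fin N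
  perm : Fin N → Fin 4 → Equiv.Perm (Fin 4)
  nbr_nbr : ∀ j f, nbr (nbr j f) (perm j f f) = j
  perm_perm : ∀ j f, perm (nbr j f) (perm j f f) = (perm j f)⁻¹
  sign_perm : ∀ j f, Equiv.Perm.sign (perm j f) = -1
  no_fixed_face : ∀ j f, ¬ (nbr j f = j ∧ perm j f f = f)

namespace IdealTriangulation

variable {N : ℕ} (T : IdealTriangulation N)

/-- A pair `(j, π)`, with `π` an even permutation, stands for the tetrahedron `j` with its
vertices listed in the positive order `π 0, π 1, π 2, π 3`, seen from its oriented edge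
`π 0 → π 1`.  Turning once about that edge, one leaves the tetrahedron through the face opposite
to `π 2` and gets to the next tetrahedron around the edge, again seen from that edge. -/
def turn (x : Fin N × Equiv.Perm (Fin 4)) : Fin N × Equiv.Perm (Fin 4) :=
  (T.nbr x.1 (x.2 2), T.perm x.1 (x.2 2) * x.2 * Equiv.swap 2 3)

/-- The `i`-th tetrahedron met when turning about the edge given by `x`. -/
def around (x : Fin N × Equiv.Perm (Fin 4)) (i : ℕ) : Fin N × Equiv.Perm (Fin 4) :=
  T.turn^[i] x

/-- The number of tetrahedra (with multiplicity) around the edge given by `x`. -/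
def valence (x : Fin N × Equiv.Perm (Fin 4)) : ℕ :=
  Function.minimalPeriod T.turn x

/-- The tetrahedron where one arrives from `j` by crossing faces successively.  The
tetrahedra of the universal cover are such paths of faces, up to homotopy. -/
def walk : Fin N → List (Fin 4) → Fin N
  | j, [] => j
  | j, f :: γ => walk (T.nbr j f) γ

end IdealTriangulation

/-! ## The algebras of shape parameters

The algebra `B` is one of `ℝ`, `ℂ` and the pseudo-complex numbers, with its conjugation `star`. -/

/-- The pseudo-complex numbers `ℝ + ℝτ`, `τ² = 1`; conjugation is `star (a + bτ) = a - bτ`. -/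
abbrev PseudoComplex : Type := QuadraticAlgebra ℝ 1 0

instance : TopologicalSpace PseudoComplex :=
  TopologicalSpace.induced (fun z => (z.re, z.im)) inferInstance

section Algebra

variable {B : Type} [CommRing B] [StarRing B] [Algebra ℝ B]

/-- `z` is space-like: its square-norm `|z|² = z z̄` is a positive real number. -/
def Spacelike (z : B) : Prop := ∃ r : ℝ, 0 < r ∧ z * star z = algebraMap ℝ B r

/-- Two vectors of `B²` define the same point of the projective line `ℙ¹B`. -/
def SamePoint (v w : Fin 2 → B) : Prop := ∃ c : Bˣ, w = (c : B) • v

/-- The Hermitian matrix `v v*` of rank one that corresponds to the point `[v]` of the ideal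
boundary `ℙ¹B`. -/
def boundaryMatrix (v : Fin 2 → B) : Matrix (Fin 2) (Fin 2) B := Matrix.vecMulVec v (star v)

/-- The standard three-simplex with its vertices removed. -/
def standardIdealSimplex : Set (Fin 4 → ℝ) := {p | (∀ a, 0 ≤ p a ∧ p a < 1) ∧ ∑ a, p a = 1}

/-- The (homogeneous form of the) map from the standard ideal simplex to the real projective
space of the real vector space of Hermitian `2 × 2` matrices. -/
def simplexMap (v : Fin 4 → Fin 2 → B) (p : Fin 4 → ℝ) : Matrix (Fin 2) (Fin 2) B :=
  ∑ a, p a • boundaryMatrix (v a)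

/-- The ideal points `[v 0], …, [v 3]` determine an ideal tetrahedron: the simplex that they
span lies in the model space `𝕏`, which is the set of (lines spanned by) Hermitian matrices `X`
with `⟨X, X⟩ = - det X < 0`.  (Replacing `v` by `τ v` changes the sign of `v v*` over the
pseudo-complex numbers, so all choices of signs are covered by the choice of the vectors.) -/
def IsIdealTetrahedron (v : Fin 4 → Fin 2 → B) : Prop :=
  ∀ p ∈ standardIdealSimplex, ∃ r : ℝ, 0 < r ∧ (simplexMap v p).det = algebraMap ℝ B r

/-- The coordinates `x₁, x₂, x₃, x₄` of the Hermitian matrix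
`!![x₁ + x₂, x₃ - x₄ κ; x₃ + x₄ κ, x₁ - x₂]`, where `re` and `im` are the coordinates of
`B = ℝ + ℝκ`. -/
def hermitianCoords (re im : B → ℝ) (X : Matrix (Fin 2) (Fin 2) B) : Fin 4 → ℝ :=
  ![(re (X 0 0) + re (X 1 1)) / 2, (re (X 0 0) - re (X 1 1)) / 2, re (X 0 1), - im (X 0 1)]

/-- The simplex map preserves the orientations, that of projective space being given by the
coordinates `x₁, x₂, x₃, x₄`. -/
def PositivelyOriented (re im : B → ℝ) (v : Fin 4 → Fin 2 → B) : Prop :=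
  0 < (Matrix.of fun a => hermitianCoords re im (boundaryMatrix (v a))).det

/-- `z` is the shape parameter (the cross ratio) of four ideal points with `[v 0], [v 1], [v 2]`
determining an ideal triangle: the isometry that takes `[v 0], [v 1], [v 2]` to `∞, 0, 1` takes
`[v 3]` to `z`. -/
def HasShape (v : Fin 4 → Fin 2 → B) (z : B) : Prop :=
  ∃ A : Matrix (Fin 2) (Fin 2) B, Spacelike A.det ∧
    SamePoint (A.mulVec (v 0)) ![1, 0] ∧ SamePoint (A.mulVec (v 1)) ![0, 1] ∧
    SamePoint (A.mulVec (v 2)) ![1, 1] ∧ SamePoint (A.mulVec (v 3)) ![z, 1]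

/-- The shape parameter of the edge `ab` of a tetrahedron with shape parameter `z` at the
edge `01`: it is `z` at `01` and `23`, `1 / (1 - z)` at `02` and `13`, and `(z - 1) / z` at `03`
and `12`. -/
def edgeParameter (z : B) (a b : Fin 4) : B :=
  if ({a, b} : Finset (Fin 4)) = {0, 1} ∨ ({a, b} : Finset (Fin 4)) = {2, 3} then z
  else if ({a, b} : Finset (Fin 4)) = {0, 2} ∨ ({a, b} : Finset (Fin 4)) = {1, 3} then
    Ring.inverse (1 - z)
  else (z - 1) * Ring.inverse z

end Algebra

/-- The dihedral angle of a collapsed tetrahedron at an edge with real shape parameter `x`. -/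
def realAngle (x : ℝ) : ℝ := if x < 0 then Real.pi else 0

/-- The dihedral angle at an edge with space-like pseudo-complex shape parameter `w`: writing
`w = ± r (cosh φ + τ sinh φ)` with `r > 0`, it is the discrete rotational part of the similarity
`w`, which is `0` for the sign `+` and `π` for the sign `-`. -/
def pseudoAngle (w : PseudoComplex) : ℝ := if w.re < 0 then Real.pi else 0

namespace IdealTriangulation

variable {N : ℕ} (T : IdealTriangulation N)

section Algebra

variable {B : Type} [CommRing B] [StarRing B] [Algebra ℝ B]

/-- The solutions of Thurston's equations over `B`.  The parameters are parameters of ideal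
tetrahedra, the product of the parameters around every edge is one, and the total dihedral angle
around every edge is `2π`.  Here `angle` gives the dihedral angle at an edge in terms of its shape
parameter; it is `realAngle`, `pseudoAngle`, or `Complex.arg` (the last for positively oriented
tetrahedra). -/
def thurstonSolutions (angle : B → ℝ) : Set (Fin N → B) :=
  {z | (∀ j, Spacelike (z j) ∧ Spacelike (1 - z j)) ∧
    ∀ (j : Fin N) (π : Equiv.Perm (Fin 4)), Equiv.Perm.sign π = 1 →
      (∏ i ∈ Finset.range (T.valence (j, π)),
        edgeParameter (z (T.around (j, π) i).1)
          ((T.around (j, π) i).2 0) ((T.around (j, π) i).2 1)) = 1 ∧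
      (∑ i ∈ Finset.range (T.valence (j, π)),
        angle (edgeParameter (z (T.around (j, π) i).1)
          ((T.around (j, π) i).2 0) ((T.around (j, π) i).2 1))) = 2 * Real.pi}

/-- The real deformation variety. -/
def realDeformationVariety : Set (Fin N → ℝ) := T.thurstonSolutions realAngle

variable (B) in
/-- A realization of the tetrahedra of `T` as ideal tetrahedra of the model space `𝕏` of `B`,
glued along their faces by isometries so that the structure extends over the edges, up to the
condition on the total dihedral angles.  The tetrahedron `j` has ideal vertices `[vertex j a]`;
the isometry `[glue j f]` in `PGL⁺(2, B)` puts the tetrahedron `nbr j f` next to the tetrahedron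
`j` along its face `f`.  The composition of the glueing isometries around every edge is the
identity of `PGL⁺(2, B)`. -/
structure Realization where
  vertex : Fin N → Fin 4 → Fin 2 → B
  glue : Fin N → Fin 4 → Matrix (Fin 2) (Fin 2) B
  ideal : ∀ j, IsIdealTetrahedron (vertex j)
  isometry : ∀ j f, Spacelike (glue j f).det
  face : ∀ j f a, a ≠ f →
    SamePoint ((glue j f).mulVec (vertex (T.nbr j f) (T.perm j f a))) (vertex j a)
  edge : ∀ (j : Fin N) (π : Equiv.Perm (Fin 4)), Equiv.Perm.sign π = 1 →
    ∃ c : Bˣ, ((List.range (T.valence (j, π))).map fun i =>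
      glue (T.around (j, π) i).1 ((T.around (j, π) i).2 2)).prod = (c : B) • 1

namespace Realization

variable {T} (S : T.Realization B)

/-- The tetrahedra of the realization have shape parameters `z j`. -/
def HasShapes (z : Fin N → B) : Prop := ∀ j, HasShape (S.vertex j) (z j)

/-- The total dihedral angle around every edge is `2π`, where `angle` gives the dihedral angle at
an edge in terms of its shape parameter. -/
def TotalAngle (angle : B → ℝ) : Prop :=
  ∀ (j : Fin N) (π : Equiv.Perm (Fin 4)), Equiv.Perm.sign π = 1 →
    ∃ w : ℕ → B,
      (∀ i, HasShape (fun a => S.vertex (T.around (j, π) i).1 ((T.around (j, π) i).2 a)) (w i)) ∧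
      ∑ i ∈ Finset.range (T.valence (j, π)), angle (w i) = 2 * Real.pi

/-- The isometry that places the last tetrahedron of a path of tetrahedra when these are
developed one after the other, starting with the tetrahedron `j`.  When the path ends at
`j`, this is the holonomy of the loop. -/
def develop : Fin N → List (Fin 4) → Matrix (Fin 2) (Fin 2) B
  | _, [] => 1
  | j, f :: γ => S.glue j f * develop (T.nbr j f) γ

/-- The ideal vertices of the last tetrahedron of a path, developed from the tetrahedron `j`.
On the tetrahedron of the universal cover given by the path, the developing map
is (the class of) `simplexMap (S.developedVertex j γ)`. -/
def developedVertex (j : Fin N) (γ : List (Fin 4)) (a : Fin 4) : Fin 2 → B :=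
  (S.develop j γ).mulVec (S.vertex (T.walk j γ) a)

end Realization

end Algebra

/-- A triangulated hyperbolic structure: positively oriented ideal tetrahedra of `ℍ³`. -/
structure HyperbolicStructure extends T.Realization ℂ where
  oriented : ∀ j, PositivelyOriented Complex.re Complex.im (vertex j)
  angle : toRealization.TotalAngle Complex.arg

/-- A triangulated anti de Sitter structure: positively oriented ideal tetrahedra of `AdS³`. -/
structure AdSStructure extends T.Realization PseudoComplex where
  oriented : ∀ j, PositivelyOriented QuadraticAlgebra.re QuadraticAlgebra.im (vertex j)
  angle : toRealization.TotalAngle pseudoAngle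

/-- A triangulated transversely hyperbolic foliation: collapsed ideal tetrahedra, that is, ideal
tetrahedra of `ℍ²`. -/
structure TransverselyHyperbolicFoliation extends T.Realization ℝ where
  angle : toRealization.TotalAngle realAngle

variable {T}

/-- The structures `S t`, `t > 0`, collapse to the foliation `F` as `t → 0`: for a suitable choice
of the developing maps (they are defined up to composition with an isometry `g t j`, where `j` is
the tetrahedron from which one develops), the ideal vertices of every developed tetrahedron
converge in `ℙ¹B` to those of the developed collapsed tetrahedron of `F`, so that the developing
maps converge to the developing map of `F`, and the holonomies converge in `PGL⁺(2, B)` to that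
of `F`. -/
def CollapsesTo {B : Type} [CommRing B] [StarRing B] [Algebra ℝ B] [TopologicalSpace B]
    (S : Set.Ioi (0 : ℝ) → T.Realization B) (F : T.TransverselyHyperbolicFoliation) : Prop :=
  ∃ g : Set.Ioi (0 : ℝ) → Fin N → Matrix (Fin 2) (Fin 2) B,
    (∀ t j, Spacelike (g t j).det) ∧
    (∀ j γ a, ∃ c : Set.Ioi (0 : ℝ) → Bˣ,
      Tendsto (fun t => (c t : B) • (g t j).mulVec ((S t).developedVertex j γ a))
        (comap Subtype.val (𝓝 0))
        (𝓝 fun k => algebraMap ℝ B (F.developedVertex j γ a k))) ∧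
    (∀ j γ, T.walk j γ = j → ∃ c : Set.Ioi (0 : ℝ) → Bˣ,
      Tendsto (fun t => (c t : B) • (g t j * (S t).develop j γ * (g t j)⁻¹))
        (comap Subtype.val (𝓝 0))
        (𝓝 ((F.develop j γ).map (algebraMap ℝ B))))

end IdealTriangulation

/-! ## Smooth points and tangent vectors -/

section Smooth

variable {E : Type*} [NormedAddCommGroup E] [NormedSpace ℝ E]

/-- The (real algebraic or analytic) set `D` is smooth at its point `z`: near `z` it is an embedded
real-analytic submanifold.  That is, it has a local parametrization `φ` at `z`, an analytic
immersion that takes the neighbourhoods of `0` to the neighbourhoods of `z` in `D`. -/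
def IsSmoothPoint (D : Set E) (z : E) : Prop :=
  ∃ (d : ℕ) (φ : (Fin d → ℝ) → E), AnalyticAt ℝ φ 0 ∧ φ 0 = z ∧
    Function.Injective (fderiv ℝ φ 0) ∧ map φ (𝓝 0) = 𝓝[D] z

/-- `v` is tangent to `D` at `z`: it is the velocity at `z` of a curve in `D`. -/
def IsTangentVector (D : Set E) (z v : E) : Prop :=
  ∃ γ : ℝ → E, γ 0 = z ∧ HasDerivAt γ v 0 ∧ ∀ᶠ s in 𝓝 0, γ s ∈ D

end Smooth

end

/-! Smoothness lets the given curve be replaced by a real-analytic curve `c` in the deformation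
variety with `c 0 = z` and velocity `v`: `v` lifts through the derivative of the local
parametrization to a vector `u`, and the line `s • u` is mapped back
(`IsSmoothPoint.exists_analytic_curve`). Both families are this curve evaluated at an imaginary
time.

Over `ℂ`, the power series of `c` extends to a holomorphic `C`, and the shapes are `C (i s) = z + i
s v + …`, whose imaginary parts are positive for small `s > 0`. The edge products are holomorphic
and equal to one for real arguments, hence near `0` by the identity theorem. Since a product is one,
its total argument is a multiple of `2π`; it tends to the real total angle `2π`, so it equals `2π`.

Over `ℝ + ℝτ`, the maps `τ ↦ 1` and `τ ↦ -1` identify the algebra with `ℝ × ℝ`. The value of `c` at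
`τ s` is then the pair `(c s, c (-s))`. The equations hold in each factor, and the angles are those
of `c s` because nearby solutions have edge parameters of equal signs.

Solutions become structures by placing each tetrahedron at `∞, 0, 1, z`. In the frame of an edge,
turning about it is `diag (parameter, 1)`, so a full turn is `diag (product, 1) = 1`. The glueings
are polynomial in the shapes, so developing maps and holonomies converge with them. A foliation with
shapes `z` agrees with this standard model up to one isometry per tetrahedron, which gives the
collapse (`collapsesTo_of_tendsto`). -/

noncomputable section

/-! ## Projective transformations -/

section Projective

variable {B : Type} [CommRing B]

namespace SamePoint

theorem refl (v : Fin 2 → B) : SamePoint v v := ⟨1, by simp⟩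

theorem symm {v w : Fin 2 → B} (h : SamePoint v w) : SamePoint w v := by
  obtain ⟨c, rfl⟩ := h
  exact ⟨c⁻¹, by simp [smul_smul]⟩

theorem trans {u v w : Fin 2 → B} (h : SamePoint u v) (h' : SamePoint v w) : SamePoint u w := by
  obtain ⟨c, rfl⟩ := h
  obtain ⟨d, rfl⟩ := h'
  exact ⟨d * c, by simp [smul_smul]⟩

theorem of_isUnit {v w : Fin 2 → B} {c : B} (hc : IsUnit c) (h : w = c • v) : SamePoint v w :=
  ⟨hc.unit, h⟩

theorem mulVec {v w : Fin 2 → B} (h : SamePoint v w) (A : Matrix (Fin 2) (Fin 2) B) :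
    SamePoint (A.mulVec v) (A.mulVec w) := by
  obtain ⟨c, rfl⟩ := h
  exact ⟨c, Matrix.mulVec_smul A _ v⟩

theorem of_eq {v w : Fin 2 → B} (h : v = w) : SamePoint v w := h ▸ refl v

end SamePoint

/-- The determinant of two vectors. -/
def wedge (v w : Fin 2 → B) : B := v 0 * w 1 - v 1 * w 0

theorem wedge_swap (v w : Fin 2 → B) : wedge w v = -wedge v w := by
  simp only [wedge]; ring

theorem wedge_smul_smul (c d : B) (v w : Fin 2 → B) :
    wedge (c • v) (d • w) = c * d * wedge v w := by
  simp only [wedge, Pi.smul_apply, smul_eq_mul]; ring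

theorem wedge_mulVec (A : Matrix (Fin 2) (Fin 2) B) (v w : Fin 2 → B) :
    wedge (A.mulVec v) (A.mulVec w) = A.det * wedge v w := by
  simp [wedge, Matrix.mulVec, dotProduct, Fin.sum_univ_two, Matrix.det_fin_two]; ring

/-- Cramer's rule without denominators. It replaces bases and division, so the projective arguments
also work over `ℝ + ℝτ`, which has zero divisors. -/
theorem wedge_relation (p q r : Fin 2 → B) :
    wedge p q • r = wedge r q • p + wedge p r • q := by
  ext k
  fin_cases k <;> simp [wedge] <;> ring

theorem SamePoint.isUnit_wedge {v w v' w' : Fin 2 → B} (h : SamePoint v v')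
    (h' : SamePoint w w') (hu : IsUnit (wedge v' w')) : IsUnit (wedge v w) := by
  obtain ⟨c, rfl⟩ := h
  obtain ⟨d, rfl⟩ := h'
  rw [wedge_smul_smul] at hu
  exact isUnit_of_mul_isUnit_right hu

/-- The projective transformation that takes `∞, 0, 1` to `[p], [q], [r]`. -/
def frame (p q r : Fin 2 → B) : Matrix (Fin 2) (Fin 2) B :=
  !![wedge r q * p 0, wedge p r * q 0; wedge r q * p 1, wedge p r * q 1]

theorem det_frame (p q r : Fin 2 → B) :
    (frame p q r).det = wedge r q * wedge p r * wedge p q := by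
  simp [frame, Matrix.det_fin_two, wedge]; ring

theorem frame_mulVec (p q r : Fin 2 → B) (x : Fin 2 → B) :
    (frame p q r).mulVec x = (wedge r q * x 0) • p + (wedge p r * x 1) • q := by
  ext k
  fin_cases k <;> simp [frame, Matrix.mulVec, dotProduct, Fin.sum_univ_two] <;> ring

theorem frame_mulVec_infinity {p q r : Fin 2 → B} (h : IsUnit (wedge r q)) :
    SamePoint ((frame p q r).mulVec ![1, 0]) p :=
  (SamePoint.of_isUnit h (by rw [frame_mulVec]; simp)).symm

theorem frame_mulVec_zero {p q r : Fin 2 → B} (h : IsUnit (wedge p r)) :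
    SamePoint ((frame p q r).mulVec ![0, 1]) q :=
  (SamePoint.of_isUnit h (by rw [frame_mulVec]; simp)).symm

theorem frame_mulVec_one {p q r : Fin 2 → B} (h : IsUnit (wedge p q)) :
    SamePoint ((frame p q r).mulVec ![1, 1]) r :=
  (SamePoint.of_isUnit h (by rw [frame_mulVec, wedge_relation]; simp)).symm

/-- The hypothesis `hz` is the cross ratio formula for `p, q, r, s` with denominators cleared. -/
theorem frame_mulVec_shape {p q r s : Fin 2 → B} {z : B} (hpq : IsUnit (wedge p q))
    (hrp : IsUnit (wedge r p)) (hsp : IsUnit (wedge s p))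
    (hz : z * (wedge r q * wedge s p) = wedge r p * wedge s q) :
    SamePoint ((frame p q r).mulVec ![z, 1]) s := by
  refine (SamePoint.of_isUnit hsp (w := wedge s p • (frame p q r).mulVec ![z, 1]) rfl).trans
    (SamePoint.of_isUnit (hrp.mul hpq) ?_).symm
  rw [mul_smul, wedge_relation p q s, frame_mulVec, smul_add, smul_add, smul_smul, smul_smul,
    smul_smul, smul_smul]
  congr 2
  · simp only [Matrix.cons_val_zero]
    linear_combination hz
  · simp only [Matrix.cons_val_one, Matrix.cons_val_zero]
    rw [wedge_swap s p, wedge_swap r p]; ring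

/-- Projectively the adjugate is the inverse. Being polynomial in the entries, it is continuous and
commutes with ring homomorphisms. -/
theorem adjugate_mulVec {A : Matrix (Fin 2) (Fin 2) B} (hA : IsUnit A.det) {v w : Fin 2 → B}
    (h : SamePoint (A.mulVec v) w) : SamePoint (A.adjugate.mulVec w) v := by
  refine (h.symm.mulVec A.adjugate).trans (SamePoint.of_isUnit hA ?_).symm
  rw [Matrix.mulVec_mulVec, Matrix.adjugate_mul, Matrix.smul_mulVec, Matrix.one_mulVec]

/-- A projective transformation is determined by the images of three points. -/
theorem eq_smul_of_samePoint {A A' : Matrix (Fin 2) (Fin 2) B} (hA' : IsUnit A'.det)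
    {p q r : Fin 2 → B} (hpq : IsUnit (wedge p q)) (hpr : IsUnit (wedge p r))
    (hrq : IsUnit (wedge r q)) (hp : SamePoint (A'.mulVec p) (A.mulVec p))
    (hq : SamePoint (A'.mulVec q) (A.mulVec q)) (hr : SamePoint (A'.mulVec r) (A.mulVec r)) :
    ∃ c : Bˣ, A = (c : B) • A' := by
  obtain ⟨α, hα⟩ := hp
  obtain ⟨β, hβ⟩ := hq
  obtain ⟨γ, hγ⟩ := hr
  have hw : IsUnit (wedge (A'.mulVec p) (A'.mulVec q)) := by
    rw [wedge_mulVec]; exact hA'.mul hpq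
  -- Both matrices respect the linear relation among `p, q, r`. Comparing the two images, and taking
  -- the wedge with `A' q` and with `A' p`, forces the three scalars to agree.
  have key : ((γ : B) * wedge r q) • A'.mulVec p + ((γ : B) * wedge p r) • A'.mulVec q
      = ((α : B) * wedge r q) • A'.mulVec p + ((β : B) * wedge p r) • A'.mulVec q := by
    have h1 := congrArg A.mulVec (wedge_relation p q r)
    have h2 := congrArg A'.mulVec (wedge_relation p q r)
    simp only [Matrix.mulVec_add, Matrix.mulVec_smul] at h1 h2
    rw [hα, hβ, hγ, smul_comm, h2] at h1
    simpa only [smul_add, smul_smul, mul_comm] using h1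
  have hαγ : (α : B) = γ := by
    refine (hrq.mul hw).mul_right_cancel ?_
    have := congrArg (fun x => wedge x (A'.mulVec q)) key
    simp only [wedge, Pi.add_apply, Pi.smul_apply, smul_eq_mul] at this ⊢
    linear_combination -this
  have hβγ : (β : B) = γ := by
    refine (hpr.mul hw).mul_right_cancel ?_
    have := congrArg (fun x => wedge (A'.mulVec p) x) key
    simp only [wedge, Pi.add_apply, Pi.smul_apply, smul_eq_mul] at this ⊢
    linear_combination -this
  refine ⟨γ, ?_⟩
  have h : ∀ x, A.mulVec x = ((γ : B) • A').mulVec x := by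
    intro x
    have hx := wedge_relation p q x
    have h1 := congrArg A.mulVec hx
    have h2 := congrArg (fun y => (γ : B) • A'.mulVec y) hx
    simp only [Matrix.mulVec_add, Matrix.mulVec_smul] at h1 h2
    rw [hα, hβ, hαγ, hβγ] at h1
    rw [smul_add, smul_comm (γ : B) (wedge x q), smul_comm (γ : B) (wedge p x), ← h1] at h2
    rw [smul_comm] at h2
    rw [Matrix.smul_mulVec]
    exact (hpq.smul_left_cancel.1 h2).symm
  ext i k
  have := congrFun (h (Pi.single k 1)) i
  simpa using this

end Projective

/-! ## Space-like numbers -/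

section Spacelike

variable {B : Type} [CommRing B] [StarRing B] [Algebra ℝ B]

namespace Spacelike

theorem one : Spacelike (1 : B) := ⟨1, one_pos, by simp⟩

theorem mul {z w : B} (hz : Spacelike z) (hw : Spacelike w) : Spacelike (z * w) := by
  obtain ⟨r, hr, h⟩ := hz
  obtain ⟨s, hs, h'⟩ := hw
  refine ⟨r * s, mul_pos hr hs, ?_⟩
  rw [map_mul, ← h, ← h', star_mul]; ring

theorem neg {z : B} (hz : Spacelike z) : Spacelike (-z) := by
  obtain ⟨r, hr, h⟩ := hz
  exact ⟨r, hr, by simpa using h⟩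

theorem isUnit {z : B} (hz : Spacelike z) : IsUnit z := by
  obtain ⟨r, hr, h⟩ := hz
  have : IsUnit (z * star z) := by
    rw [h]; exact (isUnit_iff_ne_zero.2 hr.ne').map (algebraMap ℝ B)
  exact isUnit_of_mul_isUnit_left this

end Spacelike

/-- Cauchy–Binet for the sum of the rank-one matrices `p a • v a (v a)*`; only pairs of distinct
vertices contribute. -/
theorem det_simplexMap (v : Fin 4 → Fin 2 → B) (p : Fin 4 → ℝ) :
    (simplexMap v p).det =
      ∑ x ∈ ({(0, 1), (0, 2), (0, 3), (1, 2), (1, 3), (2, 3)} : Finset (Fin 4 × Fin 4)),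
        (p x.1 * p x.2) • (wedge (v x.1) (v x.2) * star (wedge (v x.1) (v x.2))) := by
  have h : ∀ i k, simplexMap v p i k = ∑ a, algebraMap ℝ B (p a) * (v a i * star (v a k)) := by
    intro i k
    simp only [simplexMap, boundaryMatrix, Matrix.sum_apply, Matrix.smul_apply,
      Matrix.vecMulVec_apply, Pi.star_apply]
    exact Finset.sum_congr rfl fun a _ => Algebra.smul_def _ _
  simp [Matrix.det_fin_two, h, Fin.sum_univ_four, wedge, Algebra.smul_def]
  ring

theorem isIdealTetrahedron_of_spacelike {v : Fin 4 → Fin 2 → B}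
    (hv : ∀ a b, a ≠ b → Spacelike (wedge (v a) (v b))) : IsIdealTetrahedron v := by
  intro p hp
  have h : ∀ a b, ∃ r : ℝ, (a ≠ b → 0 < r) ∧
      (a ≠ b → wedge (v a) (v b) * star (wedge (v a) (v b)) = algebraMap ℝ B r) := by
    intro a b
    by_cases hab : a = b
    · exact ⟨0, fun h => absurd hab h, fun h => absurd hab h⟩
    · obtain ⟨r, hr, h⟩ := hv a b hab
      exact ⟨r, fun _ => hr, fun _ => h⟩
  choose r hr hw using h
  refine ⟨∑ x ∈ ({(0, 1), (0, 2), (0, 3), (1, 2), (1, 3), (2, 3)} : Finset (Fin 4 × Fin 4)),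
    p x.1 * p x.2 * r x.1 x.2, ?_, ?_⟩
  · obtain ⟨h1, h2⟩ := hp
    rw [Fin.sum_univ_four] at h2
    have hne : ∀ x ∈ ({(0, 1), (0, 2), (0, 3), (1, 2), (1, 3), (2, 3)} :
        Finset (Fin 4 × Fin 4)), x.1 ≠ x.2 := by decide
    refine Finset.sum_pos' (fun x hx => mul_nonneg (mul_nonneg (h1 _).1 (h1 _).1)
      (hr _ _ (hne x hx)).le) ?_
    by_contra! hcon
    have hz : ∀ x ∈ ({(0, 1), (0, 2), (0, 3), (1, 2), (1, 3), (2, 3)} :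
        Finset (Fin 4 × Fin 4)), p x.1 * p x.2 = 0 := by
      intro x hx
      refine le_antisymm ?_ (mul_nonneg (h1 _).1 (h1 _).1)
      exact nonpos_of_mul_nonpos_left (hcon x hx) (hr _ _ (hne x hx))
    have e01 := hz (0, 1) (by decide)
    have e02 := hz (0, 2) (by decide)
    have e03 := hz (0, 3) (by decide)
    have e12 := hz (1, 2) (by decide)
    have e13 := hz (1, 3) (by decide)
    have e23 := hz (2, 3) (by decide)
    simp only [mul_eq_zero] at e01 e02 e03 e12 e13 e23
    have l0 := (h1 0).2
    have l1 := (h1 1).2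
    have l2 := (h1 2).2
    have l3 := (h1 3).2
    -- If all pairwise products vanish, at most one weight is nonzero; it would equal `1`, the
    -- vertex excluded from the ideal simplex.
    rcases e01 with e | e <;> rcases e23 with e' | e' <;> rcases e02 with f | f <;>
      rcases e13 with f' | f' <;> rcases e03 with g | g <;> rcases e12 with g' | g' <;> linarith
  · rw [det_simplexMap, map_sum]
    refine Finset.sum_congr rfl fun x hx => ?_
    have hne : x.1 ≠ x.2 := by
      revert x; decide
    rw [hw _ _ hne, Algebra.smul_def, map_mul, map_mul, map_mul]

end Spacelike

/-! ## Tetrahedra in standard position -/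

section Standard

variable {B : Type} [CommRing B]

/-- The vertices `∞, 0, 1, z` of a tetrahedron in standard position. -/
def standardVertex (z : B) : Fin 4 → Fin 2 → B := ![![1, 0], ![0, 1], ![1, 1], ![z, 1]]

/-- The rows are grouped by the edge `π 0, π 1`: parameter `z`, then `1 / (1 - z)`, then `(z - 1) /
z`. -/
theorem even_perm_values (π : Equiv.Perm (Fin 4)) (hπ : Equiv.Perm.sign π = 1) :
    (π 0, π 1, π 2, π 3) ∈ ([(0, 1, 2, 3), (1, 0, 3, 2), (2, 3, 0, 1), (3, 2, 1, 0),
      (0, 2, 3, 1), (2, 0, 1, 3), (3, 1, 0, 2), (1, 3, 2, 0),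
      (0, 3, 1, 2), (3, 0, 2, 1), (1, 2, 0, 3), (2, 1, 3, 0)] :
        List (Fin 4 × Fin 4 × Fin 4 × Fin 4)) := by
  revert π; decide

/-- For the vertices `∞, 0, 1, z` the coordinate matrix is block triangular with determinant `im z /
2`. -/
theorem positivelyOriented_standardVertex [StarRing B] {re im : B → ℝ} {z : B} (h0 : re 0 = 0)
    (h1 : re 1 = 1) (h0' : im 0 = 0) (h1' : im 1 = 0) (hz : 0 < im z) :
    PositivelyOriented re im (standardVertex z) := by
  rw [PositivelyOriented, Matrix.det_succ_row_zero]
  simp [Fin.sum_univ_four, Matrix.det_fin_three, hermitianCoords, boundaryMatrix,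
    Matrix.vecMulVec_apply, standardVertex, Fin.succAbove, h0, h1, h0', h1']
  linarith

variable [StarRing B] [Algebra ℝ B]

theorem spacelike_wedge_standardVertex {z : B} (hz : Spacelike z) (hz' : Spacelike (1 - z))
    (a b : Fin 4) (hab : a ≠ b) :
    Spacelike (wedge (standardVertex z a) (standardVertex z b)) := by
  have h1 := Spacelike.one (B := B)
  have hz'' : Spacelike (z - 1) := by simpa using hz'.neg
  fin_cases a <;> fin_cases b <;>
    simp [wedge, standardVertex, h1, h1.neg, hz, hz.neg, hz', hz''] at hab ⊢

/-- The edge parameter is the cross ratio of the vertices in any positive order starting with that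
edge; an even permutation changes `z` only by the order-three substitution `z ↦ 1 / (1 - z)`. -/
theorem edgeParameter_mul_wedge {z : B} (hz : Spacelike z) (hz' : Spacelike (1 - z))
    (π : Equiv.Perm (Fin 4)) (hπ : Equiv.Perm.sign π = 1) :
    edgeParameter z (π 0) (π 1) *
        (wedge (standardVertex z (π 2)) (standardVertex z (π 1)) *
          wedge (standardVertex z (π 3)) (standardVertex z (π 0))) =
      wedge (standardVertex z (π 2)) (standardVertex z (π 0)) *
        wedge (standardVertex z (π 3)) (standardVertex z (π 1)) := by
  have h := even_perm_values π hπ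
  have i1 := Ring.inverse_mul_cancel z hz.isUnit
  have i2 := Ring.inverse_mul_cancel (1 - z) hz'.isUnit
  generalize π 0 = a, π 1 = b, π 2 = c, π 3 = d at h
  simp only [List.mem_cons, List.not_mem_nil, or_false, Prod.mk.injEq] at h
  have e1 : edgeParameter z 0 1 = z ∧ edgeParameter z 1 0 = z ∧ edgeParameter z 2 3 = z ∧
      edgeParameter z 3 2 = z := by
    refine ⟨?_, ?_, ?_, ?_⟩ <;> exact if_pos (by decide)
  have e2 : edgeParameter z 0 2 = Ring.inverse (1 - z) ∧
      edgeParameter z 2 0 = Ring.inverse (1 - z) ∧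
      edgeParameter z 1 3 = Ring.inverse (1 - z) ∧
      edgeParameter z 3 1 = Ring.inverse (1 - z) := by
    refine ⟨?_, ?_, ?_, ?_⟩ <;> exact (if_neg (by decide)).trans (if_pos (by decide))
  have e3 : edgeParameter z 0 3 = (z - 1) * Ring.inverse z ∧
      edgeParameter z 3 0 = (z - 1) * Ring.inverse z ∧
      edgeParameter z 1 2 = (z - 1) * Ring.inverse z ∧
      edgeParameter z 2 1 = (z - 1) * Ring.inverse z := by
    refine ⟨?_, ?_, ?_, ?_⟩ <;> exact (if_neg (by decide)).trans (if_neg (by decide))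
  rcases h with h | h | h | h | h | h | h | h | h | h | h | h <;>
    obtain ⟨rfl, rfl, rfl, rfl⟩ := h <;>
    simp only [e1, e2, e3, wedge, standardVertex, Matrix.cons_val] <;>
    first
      | ring1
      | linear_combination i2
      | linear_combination -i2
      | linear_combination (1 - z) * i1
      | linear_combination (z - 1) * i1

theorem hasShape_of_wedge {v : Fin 4 → Fin 2 → B} {w : B}
    (hv : ∀ a b, a ≠ b → Spacelike (wedge (v a) (v b)))
    (hw : w * (wedge (v 2) (v 1) * wedge (v 3) (v 0)) = wedge (v 2) (v 0) * wedge (v 3) (v 1)) :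
    HasShape v w := by
  have hd : Spacelike (frame (v 0) (v 1) (v 2)).det := by
    rw [det_frame]
    exact ((hv 2 1 (by decide)).mul (hv 0 2 (by decide))).mul (hv 0 1 (by decide))
  refine ⟨(frame (v 0) (v 1) (v 2)).adjugate, ?_,
    adjugate_mulVec hd.isUnit (frame_mulVec_infinity (hv 2 1 (by decide)).isUnit),
    adjugate_mulVec hd.isUnit (frame_mulVec_zero (hv 0 2 (by decide)).isUnit),
    adjugate_mulVec hd.isUnit (frame_mulVec_one (hv 0 1 (by decide)).isUnit),
    adjugate_mulVec hd.isUnit (frame_mulVec_shape (hv 0 1 (by decide)).isUnit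
      (hv 2 0 (by decide)).isUnit (hv 3 0 (by decide)).isUnit hw)⟩
  rw [Matrix.det_adjugate]
  simpa using hd

theorem hasShape_standardVertex_perm {z : B} (hz : Spacelike z) (hz' : Spacelike (1 - z))
    (π : Equiv.Perm (Fin 4)) (hπ : Equiv.Perm.sign π = 1) :
    HasShape (fun a => standardVertex z (π a)) (edgeParameter z (π 0) (π 1)) :=
  hasShape_of_wedge
    (fun _ _ hab => spacelike_wedge_standardVertex hz hz' _ _ (π.injective.ne hab))
    (edgeParameter_mul_wedge hz hz' π hπ)

theorem hasShape_standardVertex {z : B} (hz : Spacelike z) (hz' : Spacelike (1 - z)) :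
    HasShape (standardVertex z) z := by
  have h := hasShape_standardVertex_perm hz hz' 1 (by simp)
  rwa [show edgeParameter z ((1 : Equiv.Perm (Fin 4)) 0) ((1 : Equiv.Perm (Fin 4)) 1) = z from
    if_pos (by decide)] at h

theorem samePoint_standardVertex_of_hasShape {v : Fin 4 → Fin 2 → B} {z : B} (h : HasShape v z) :
    ∃ A : Matrix (Fin 2) (Fin 2) B, Spacelike A.det ∧
      ∀ a, SamePoint (A.mulVec (v a)) (standardVertex z a) := by
  obtain ⟨A, hA, h0, h1, h2, h3⟩ := h
  refine ⟨A, hA, fun a => ?_⟩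
  fin_cases a
  exacts [h0, h1, h2, h3]

end Standard

/-! ## The realization with given shape parameters -/

namespace IdealTriangulation

variable {N : ℕ} (T : IdealTriangulation N)

theorem sign_turn (x : Fin N × Equiv.Perm (Fin 4)) :
    Equiv.Perm.sign (T.turn x).2 = Equiv.Perm.sign x.2 := by
  simp [turn, T.sign_perm]

theorem around_succ (x : Fin N × Equiv.Perm (Fin 4)) (i : ℕ) :
    T.around x (i + 1) = T.turn (T.around x i) :=
  Function.iterate_succ_apply' _ _ _

theorem around_valence (x : Fin N × Equiv.Perm (Fin 4)) : T.around x (T.valence x) = x :=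
  Function.iterate_minimalPeriod

theorem sign_around (x : Fin N × Equiv.Perm (Fin 4)) (i : ℕ) :
    Equiv.Perm.sign (T.around x i).2 = Equiv.Perm.sign x.2 := by
  induction i with
  | zero => rfl
  | succ i ih => rw [around_succ, sign_turn, ih]

section Algebra

variable {B : Type} [CommRing B]

/-- The glueing isometry at the face `f` of the tetrahedron `j`, when all tetrahedra are in
standard position. -/
def standardGlue (z : Fin N → B) (j : Fin N) (f : Fin 4) : Matrix (Fin 2) (Fin 2) B :=
  frame (standardVertex (z j) (f + 1)) (standardVertex (z j) (f + 2))
      (standardVertex (z j) (f + 3)) *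
    (frame (standardVertex (z (T.nbr j f)) (T.perm j f (f + 1)))
      (standardVertex (z (T.nbr j f)) (T.perm j f (f + 2)))
      (standardVertex (z (T.nbr j f)) (T.perm j f (f + 3)))).adjugate

/-- The isometry that places the last tetrahedron of a path, when all tetrahedra are in standard
position. -/
def standardDevelop (z : Fin N → B) : Fin N → List (Fin 4) → Matrix (Fin 2) (Fin 2) B
  | _, [] => 1
  | j, f :: γ => T.standardGlue z j f * standardDevelop z (T.nbr j f) γ

variable [StarRing B] [Algebra ℝ B] {T}
variable {z : Fin N → B}

theorem spacelike_det_frame_standardVertex (hz : ∀ j, Spacelike (z j) ∧ Spacelike (1 - z j))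
    (j : Fin N) {a b c : Fin 4} (hab : a ≠ b) (hac : a ≠ c) (hcb : c ≠ b) :
    Spacelike (frame (standardVertex (z j) a) (standardVertex (z j) b)
      (standardVertex (z j) c)).det := by
  rw [det_frame]
  exact ((spacelike_wedge_standardVertex (hz j).1 (hz j).2 _ _ hcb).mul
    (spacelike_wedge_standardVertex (hz j).1 (hz j).2 _ _ hac)).mul
    (spacelike_wedge_standardVertex (hz j).1 (hz j).2 _ _ hab)

theorem face_vertices_distinct (f : Fin 4) : f + 1 ≠ f + 2 ∧ f + 1 ≠ f + 3 ∧ f + 3 ≠ f + 2 := by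
  revert f; decide

theorem eq_add_of_ne {a f : Fin 4} (h : a ≠ f) : a = f + 1 ∨ a = f + 2 ∨ a = f + 3 := by
  revert a f; decide

theorem add_ne_self_of_face (f : Fin 4) : f + 1 ≠ f ∧ f + 2 ≠ f ∧ f + 3 ≠ f := by
  revert f; decide

theorem spacelike_det_standardGlue (hz : ∀ j, Spacelike (z j) ∧ Spacelike (1 - z j)) (j : Fin N)
    (f : Fin 4) : Spacelike (T.standardGlue z j f).det := by
  obtain ⟨h1, h2, h3⟩ := face_vertices_distinct f
  rw [standardGlue, Matrix.det_mul, Matrix.det_adjugate]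
  have inj := (T.perm j f).injective
  refine (spacelike_det_frame_standardVertex hz _ h1 h2 h3).mul ?_
  simpa using spacelike_det_frame_standardVertex hz (T.nbr j f) (inj.ne h1) (inj.ne h2) (inj.ne h3)

theorem samePoint_standardGlue (hz : ∀ j, Spacelike (z j) ∧ Spacelike (1 - z j)) (j : Fin N)
    (f a : Fin 4) (h : a ≠ f) :
    SamePoint ((T.standardGlue z j f).mulVec
      (standardVertex (z (T.nbr j f)) (T.perm j f a))) (standardVertex (z j) a) := by
  obtain ⟨h1, h2, h3⟩ := face_vertices_distinct f
  have inj := (T.perm j f).injective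
  have hd := (spacelike_det_frame_standardVertex hz (T.nbr j f) (inj.ne h1) (inj.ne h2)
    (inj.ne h3)).isUnit
  have W := fun i a b hab => (spacelike_wedge_standardVertex (hz i).1 (hz i).2 a b hab).isUnit
  rw [standardGlue, ← Matrix.mulVec_mulVec]
  rcases eq_add_of_ne h with rfl | rfl | rfl
  · exact ((adjugate_mulVec hd (frame_mulVec_infinity (W _ _ _ (inj.ne h3)))).mulVec _).trans
      (frame_mulVec_infinity (W _ _ _ h3))
  · exact ((adjugate_mulVec hd (frame_mulVec_zero (W _ _ _ (inj.ne h2)))).mulVec _).trans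
      (frame_mulVec_zero (W _ _ _ h2))
  · exact ((adjugate_mulVec hd (frame_mulVec_one (W _ _ _ (inj.ne h1)))).mulVec _).trans
      (frame_mulVec_one (W _ _ _ h1))

/-- The frame of a tetrahedron in standard position, seen from one of its oriented edges. -/
def edgeFrame (z : Fin N → B) (x : Fin N × Equiv.Perm (Fin 4)) : Matrix (Fin 2) (Fin 2) B :=
  frame (standardVertex (z x.1) (x.2 0)) (standardVertex (z x.1) (x.2 1))
    (standardVertex (z x.1) (x.2 2))

theorem spacelike_det_edgeFrame (hz : ∀ j, Spacelike (z j) ∧ Spacelike (1 - z j))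
    (x : Fin N × Equiv.Perm (Fin 4)) : Spacelike (edgeFrame z x).det :=
  spacelike_det_frame_standardVertex hz _ (x.2.injective.ne (by decide))
    (x.2.injective.ne (by decide)) (x.2.injective.ne (by decide))

/-- Turning once about an edge multiplies by the shape parameter. -/
theorem standardGlue_mul_edgeFrame (hz : ∀ j, Spacelike (z j) ∧ Spacelike (1 - z j))
    (x : Fin N × Equiv.Perm (Fin 4)) (hx : Equiv.Perm.sign x.2 = 1) :
    ∃ c : Bˣ, T.standardGlue z x.1 (x.2 2) * edgeFrame z (T.turn x) =
      (c : B) • (edgeFrame z x * Matrix.diagonal ![edgeParameter (z x.1) (x.2 0) (x.2 1), 1]) := by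
  have W := fun i a b hab => (spacelike_wedge_standardVertex (hz i).1 (hz i).2 a b hab).isUnit
  have inj := x.2.injective
  have inj' := (T.perm x.1 (x.2 2)).injective
  have hE := edgeParameter_mul_wedge (hz x.1).1 (hz x.1).2 x.2 hx
  set w := edgeParameter (z x.1) (x.2 0) (x.2 1) with hw
  have hwu : IsUnit w := by
    have := (W x.1 _ _ (inj.ne (show (2 : Fin 4) ≠ 0 by decide))).mul
      (W x.1 _ _ (inj.ne (show (3 : Fin 4) ≠ 1 by decide)))
    rw [← hE] at this
    exact isUnit_of_mul_isUnit_left this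
  have t0 : (T.turn x).2 0 = T.perm x.1 (x.2 2) (x.2 0) := by simp [turn]; rfl
  have t1 : (T.turn x).2 1 = T.perm x.1 (x.2 2) (x.2 1) := by simp [turn]; rfl
  have t2 : (T.turn x).2 2 = T.perm x.1 (x.2 2) (x.2 3) := by simp [turn]
  have tj : (T.turn x).1 = T.nbr x.1 (x.2 2) := rfl
  -- Compare both sides at `∞, 0, 1`. The ends of the edge are kept, while the third vertex of the
  -- turned frame is glued to the old fourth vertex, which has coordinate `w` in the old frame.
  refine eq_smul_of_samePoint (p := ![1, 0]) (q := ![0, 1]) (r := ![1, 1]) ?_ (by simp [wedge])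
    (by simp [wedge]) (by simp [wedge]) ?_ ?_ ?_
  · rw [Matrix.det_mul, Matrix.det_diagonal]
    simpa using (spacelike_det_edgeFrame hz x).isUnit.mul hwu
  all_goals rw [← Matrix.mulVec_mulVec, ← Matrix.mulVec_mulVec]
  all_goals simp only [edgeFrame, tj, t0, t1, t2]
  · refine (SamePoint.mulVec (SamePoint.of_isUnit hwu ?_ : SamePoint ![(1 : B), 0] _).symm _).trans
      ((frame_mulVec_infinity (W _ _ _ (inj.ne (by decide)))).trans
      (((frame_mulVec_infinity (W _ _ _ (inj'.ne (inj.ne (by decide))))).mulVec _).trans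
        (samePoint_standardGlue hz _ _ _ (inj.ne (by decide)))).symm)
    ext k; fin_cases k <;> simp [Matrix.mulVec_diagonal]
  · refine (SamePoint.mulVec (SamePoint.of_eq ?_ : SamePoint ![(0 : B), 1] _).symm _).trans
      ((frame_mulVec_zero (W _ _ _ (inj.ne (by decide)))).trans
      (((frame_mulVec_zero (W _ _ _ (inj'.ne (inj.ne (by decide))))).mulVec _).trans
        (samePoint_standardGlue hz _ _ _ (inj.ne (by decide)))).symm)
    ext k; fin_cases k <;> simp [Matrix.mulVec_diagonal]
  · refine (SamePoint.mulVec (SamePoint.of_eq ?_ : SamePoint ![w, 1] _).symm _).trans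
      ((frame_mulVec_shape (W _ _ _ (inj.ne (by decide))) (W _ _ _ (inj.ne (by decide)))
        (W _ _ _ (inj.ne (by decide))) hE).trans
      (((frame_mulVec_one (W _ _ _ (inj'.ne (inj.ne (by decide))))).mulVec _).trans
        (samePoint_standardGlue hz _ _ _ (inj.ne (by decide)))).symm)
    ext k; fin_cases k <;> simp [Matrix.mulVec_diagonal]

/-- The single turns telescope: expressed in the frame of the initial edge each one is diagonal, so
the parameters multiply. -/
theorem prod_standardGlue_mul_edgeFrame (hz : ∀ j, Spacelike (z j) ∧ Spacelike (1 - z j))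
    (x : Fin N × Equiv.Perm (Fin 4)) (hx : Equiv.Perm.sign x.2 = 1) (n : ℕ) :
    ∃ c : Bˣ, ((List.range n).map fun i =>
        T.standardGlue z (T.around x i).1 ((T.around x i).2 2)).prod * edgeFrame z (T.around x n) =
      (c : B) • (edgeFrame z x * Matrix.diagonal ![∏ i ∈ Finset.range n,
        edgeParameter (z (T.around x i).1) ((T.around x i).2 0) ((T.around x i).2 1), 1]) := by
  induction n with
  | zero =>
    refine ⟨1, ?_⟩
    have : Matrix.diagonal ![(1 : B), 1] = 1 := by
      rw [← Matrix.diagonal_one]; congr 1; ext k; fin_cases k <;> rfl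
    simp [around, this]
  | succ n ih =>
    obtain ⟨c, hc⟩ := ih
    obtain ⟨d, hd⟩ := standardGlue_mul_edgeFrame (T := T) hz (T.around x n)
      (by rw [sign_around, hx])
    refine ⟨d * c, ?_⟩
    rw [List.range_succ, List.map_append, List.prod_append, around_succ, List.map_singleton,
      List.prod_singleton, Matrix.mul_assoc, hd, Matrix.mul_smul, ← Matrix.mul_assoc, hc,
      Matrix.smul_mul, smul_smul, Matrix.mul_assoc, Matrix.diagonal_mul_diagonal,
      Finset.prod_range_succ, Units.val_mul]
    congr 3
    ext k; fin_cases k <;> simp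

variable (T) in
/-- The realization of a solution of Thurston's equations by tetrahedra in standard position. -/
def standardRealization {angle : B → ℝ} (hz : z ∈ T.thurstonSolutions angle) :
    T.Realization B where
  vertex j := standardVertex (z j)
  glue := T.standardGlue z
  ideal j := isIdealTetrahedron_of_spacelike
    (spacelike_wedge_standardVertex (hz.1 j).1 (hz.1 j).2)
  isometry := spacelike_det_standardGlue hz.1
  face := samePoint_standardGlue hz.1
  edge j π hπ := by
    obtain ⟨c, hc⟩ := prod_standardGlue_mul_edgeFrame (T := T) hz.1 (j, π) hπ (T.valence (j, π))
    refine ⟨c, ?_⟩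
    have h1 : Matrix.diagonal ![(1 : B), 1] = 1 := by
      rw [← Matrix.diagonal_one]; congr 1; ext k; fin_cases k <;> rfl
    -- After a full turn the frame is the initial one and the diagonal factor is the identity;
    -- cancelling the invertible frame leaves a scalar.
    rw [around_valence, (hz.2 j π hπ).1, h1, Matrix.mul_one] at hc
    have hu := (spacelike_det_edgeFrame hz.1 (j, π)).isUnit
    have := congrArg (· * (edgeFrame z (j, π))⁻¹) hc
    simpa only [Matrix.mul_assoc, Matrix.smul_mul, Matrix.mul_nonsing_inv _ hu,
      Matrix.mul_one] using this

variable {angle : B → ℝ} (hz : z ∈ T.thurstonSolutions angle)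

theorem standardRealization_hasShapes : (T.standardRealization hz).HasShapes z :=
  fun j => hasShape_standardVertex (hz.1 j).1 (hz.1 j).2

theorem standardRealization_totalAngle : (T.standardRealization hz).TotalAngle angle :=
  fun j π hπ => ⟨_, fun i => hasShape_standardVertex_perm (hz.1 _).1 (hz.1 _).2 _
    (by rw [sign_around]; exact hπ), (hz.2 j π hπ).2⟩

theorem standardRealization_develop (j : Fin N) (γ : List (Fin 4)) :
    (T.standardRealization hz).develop j γ = T.standardDevelop z j γ := by
  induction γ generalizing j with
  | nil => rfl
  | cons f γ ih => exact congrArg (T.standardGlue z j f * ·) (ih _)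

/-- The developing map of a realization agrees with that of the tetrahedra in standard
position. -/
theorem Realization.develop_eq_smul (S : T.Realization B)
    (hz : ∀ j, Spacelike (z j) ∧ Spacelike (1 - z j))
    {A : Fin N → Matrix (Fin 2) (Fin 2) B} (hA : ∀ j, Spacelike (A j).det)
    (hS : ∀ j a, SamePoint ((A j).mulVec (S.vertex j a)) (standardVertex (z j) a))
    (j : Fin N) (γ : List (Fin 4)) :
    ∃ c : Bˣ, A j * S.develop j γ = (c : B) • (T.standardDevelop z j γ * A (T.walk j γ)) := by
  induction γ generalizing j with
  | nil => exact ⟨1, by simp [develop, standardDevelop, walk]⟩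
  | cons f γ ih =>
    obtain ⟨c, hc⟩ := ih (T.nbr j f)
    -- Both sides send the three vertices of the common face to the same points, so they agree
    -- projectively.
    have hg : ∃ d : Bˣ, A j * S.glue j f = (d : B) • (T.standardGlue z j f * A (T.nbr j f)) := by
      have W : ∀ a b, a ≠ b → IsUnit (wedge (S.vertex (T.nbr j f) a) (S.vertex (T.nbr j f) b)) := by
        intro a b hab
        have := SamePoint.isUnit_wedge (hS (T.nbr j f) a) (hS (T.nbr j f) b)
          (spacelike_wedge_standardVertex (hz _).1 (hz _).2 a b hab).isUnit
        rw [wedge_mulVec] at this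
        exact isUnit_of_mul_isUnit_right this
      have P : ∀ a, a ≠ f → SamePoint
          ((T.standardGlue z j f * A (T.nbr j f)).mulVec (S.vertex (T.nbr j f) (T.perm j f a)))
          ((A j * S.glue j f).mulVec (S.vertex (T.nbr j f) (T.perm j f a))) := by
        intro a ha
        rw [← Matrix.mulVec_mulVec, ← Matrix.mulVec_mulVec]
        exact (((hS _ _).mulVec _).trans (samePoint_standardGlue hz j f a ha)).trans
          (((S.face j f a ha).mulVec _).trans (hS j a)).symm
      obtain ⟨h1, h2, h3⟩ := face_vertices_distinct f
      obtain ⟨n1, n2, n3⟩ := add_ne_self_of_face f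
      have inj := (T.perm j f).injective
      refine eq_smul_of_samePoint ?_ (W _ _ (inj.ne h1)) (W _ _ (inj.ne h2)) (W _ _ (inj.ne h3))
        (P _ n1) (P _ n2) (P _ n3)
      rw [Matrix.det_mul]
      exact (spacelike_det_standardGlue hz j f).isUnit.mul (hA _).isUnit
    obtain ⟨d, hd⟩ := hg
    refine ⟨d * c, ?_⟩
    rw [develop, standardDevelop, walk, ← Matrix.mul_assoc, hd, Matrix.smul_mul, Matrix.mul_assoc,
      hc, Matrix.mul_smul, smul_smul, Units.val_mul, Matrix.mul_assoc]

end Algebra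

/-! ## Collapse of the realizations -/

section Collapse

variable {B : Type} [CommRing B] [TopologicalSpace B]

theorem continuous_standardVertex (a : Fin 4) :
    Continuous fun z : B => standardVertex z a := by
  refine continuous_pi fun k => ?_
  fin_cases a <;> fin_cases k <;> simp only [standardVertex] <;> first
    | exact continuous_const
    | exact continuous_id

variable [IsTopologicalRing B]

theorem continuous_wedge {X : Type*} [TopologicalSpace X] {p q : X → Fin 2 → B}
    (hp : Continuous p) (hq : Continuous q) : Continuous fun x => wedge (p x) (q x) := by
  unfold wedge; fun_prop

theorem continuous_frame {X : Type*} [TopologicalSpace X] {p q r : X → Fin 2 → B}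
    (hp : Continuous p) (hq : Continuous q) (hr : Continuous r) :
    Continuous fun x => frame (p x) (q x) (r x) := by
  have h1 := continuous_wedge hr hq
  have h2 := continuous_wedge hp hr
  refine continuous_matrix fun i k => ?_
  fin_cases i <;> fin_cases k <;> simp only [frame] <;> simp <;> fun_prop

theorem continuous_standardGlue (j : Fin N) (f : Fin 4) :
    Continuous fun z : Fin N → B => T.standardGlue z j f := by
  have h : ∀ j a, Continuous fun z : Fin N → B => standardVertex (z j) a :=
    fun j a => (continuous_standardVertex a).comp (continuous_apply j)
  exact (continuous_frame (h _ _) (h _ _) (h _ _)).matrix_mul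
    (continuous_frame (h _ _) (h _ _) (h _ _)).matrix_adjugate

theorem continuous_standardDevelop (j : Fin N) (γ : List (Fin 4)) :
    Continuous fun z : Fin N → B => T.standardDevelop z j γ := by
  induction γ generalizing j with
  | nil => exact continuous_const
  | cons f γ ih => exact (T.continuous_standardGlue j f).matrix_mul (ih _)

theorem standardVertex_map {R S : Type} [CommRing R] [CommRing S] (g : R →+* S) (z : R)
    (a : Fin 4) : standardVertex (g z) a = fun k => g (standardVertex z a k) := by
  ext k; fin_cases a <;> fin_cases k <;> simp [standardVertex]

theorem wedge_map {R S : Type} [CommRing R] [CommRing S] (g : R →+* S) (p q : Fin 2 → R) :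
    wedge (fun k => g (p k)) (fun k => g (q k)) = g (wedge p q) := by
  simp [wedge]

theorem frame_map {R S : Type} [CommRing R] [CommRing S] (g : R →+* S) (p q r : Fin 2 → R) :
    frame (fun k => g (p k)) (fun k => g (q k)) (fun k => g (r k)) = (frame p q r).map g := by
  ext i k; fin_cases i <;> fin_cases k <;> simp [frame, wedge_map]

/-- Developing is polynomial in the shapes. With `g = algebraMap ℝ B` this identifies the limit over
`B` with the real developing map. -/
theorem standardDevelop_map {R S : Type} [CommRing R] [CommRing S] (g : R →+* S) (z : Fin N → R)
    (j : Fin N) (γ : List (Fin 4)) :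
    T.standardDevelop (fun i => g (z i)) j γ = (T.standardDevelop z j γ).map g := by
  induction γ generalizing j with
  | nil => simp [standardDevelop]
  | cons f γ ih =>
    rw [standardDevelop, standardDevelop, ih, Matrix.map_mul]
    congr 1
    simp only [standardGlue, standardVertex_map, frame_map, Matrix.map_mul]
    congr 1
    exact (g.map_adjugate _).symm

variable {T} [StarRing B] [Algebra ℝ B]

/-- Realizations by tetrahedra in standard position collapse when the shape parameters
become real. -/
theorem collapsesTo_of_tendsto {z : Fin N → ℝ} (hz : z ∈ T.realDeformationVariety)
    (hstar : ∀ r : ℝ, star (algebraMap ℝ B r) = algebraMap ℝ B r)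
    {ζ : Set.Ioi (0 : ℝ) → Fin N → B} {angle : B → ℝ} (hζ : ∀ t, ζ t ∈ T.thurstonSolutions angle)
    (hlim : Tendsto ζ (comap Subtype.val (𝓝 0)) (𝓝 fun j => algebraMap ℝ B (z j)))
    (F : T.TransverselyHyperbolicFoliation) (hF : F.HasShapes z) :
    CollapsesTo (fun t => T.standardRealization (hζ t)) F := by
  choose A hA hAF using fun j => samePoint_standardVertex_of_hasShape (hF j)
  have hAu : ∀ j, IsUnit (A j).det := fun j => (hA j).isUnit
  have hdev := F.toRealization.develop_eq_smul hz.1 hA hAF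
  have hdev' : ∀ j γ, ∃ c : ℝˣ, F.develop j γ =
      (c : ℝ) • ((A j)⁻¹ * T.standardDevelop z j γ * A (T.walk j γ)) := by
    intro j γ
    obtain ⟨c, hc⟩ := hdev j γ
    refine ⟨c, ?_⟩
    have := congrArg ((A j)⁻¹ * ·) hc
    simpa only [← Matrix.mul_assoc, Matrix.mul_smul, Matrix.nonsing_inv_mul _ (hAu j),
      Matrix.one_mul] using this
  have hmap : ∀ c : ℝˣ, IsUnit (algebraMap ℝ B c) := fun c => c.isUnit.map _
  have hdlim : ∀ j γ, Tendsto (fun t => T.standardDevelop (ζ t) j γ) (comap Subtype.val (𝓝 0))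
      (𝓝 ((T.standardDevelop z j γ).map (algebraMap ℝ B))) := by
    intro j γ
    rw [← standardDevelop_map]
    exact ((T.continuous_standardDevelop j γ).tendsto _).comp hlim
  -- The normalizing isometry does not depend on `t`: it carries the standard tetrahedron `j` of
  -- shape `z j` to the one of `F`. The scalars below are constant too and absorb the projective
  -- ambiguity between `F` and the standard model.
  refine ⟨fun _ j => (A j)⁻¹.map (algebraMap ℝ B), ?_, ?_, ?_⟩
  · intro _ j
    have : ((A j)⁻¹.map (algebraMap ℝ B)).det = algebraMap ℝ B (A j)⁻¹.det :=
      ((algebraMap ℝ B).map_det _).symm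
    rw [this]
    refine ⟨(A j)⁻¹.det ^ 2, ?_, ?_⟩
    · have : (A j)⁻¹.det ≠ 0 := by
        simpa [Matrix.det_nonsing_inv] using (hAu j).ne_zero
      positivity
    · rw [hstar, ← map_mul, sq]
  · intro j γ a
    obtain ⟨c, hc⟩ := hdev' j γ
    obtain ⟨d, hd⟩ := (hAF (T.walk j γ) a).symm
    refine ⟨fun _ => (hmap (c * d)).unit, ?_⟩
    have hlim' : (fun k => algebraMap ℝ B (F.developedVertex j γ a k)) =
        algebraMap ℝ B (c * d) • ((A j)⁻¹.map (algebraMap ℝ B)).mulVec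
          (((T.standardDevelop z j γ).map (algebraMap ℝ B)).mulVec
            (standardVertex (algebraMap ℝ B (z (T.walk j γ))) a)) := by
      have h1 : F.developedVertex j γ a = ((c : ℝ) * d) • (A j)⁻¹.mulVec
          ((T.standardDevelop z j γ).mulVec (standardVertex (z (T.walk j γ)) a)) := by
        rw [Realization.developedVertex, hc, Matrix.smul_mulVec, ← Matrix.mulVec_mulVec, hd,
          Matrix.mulVec_smul, smul_smul, Matrix.mulVec_mulVec]
      rw [standardVertex_map]
      ext k
      have h2 := fun (M : Matrix (Fin 2) (Fin 2) ℝ) (u : Fin 2 → ℝ) =>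
        (funext fun i => (algebraMap ℝ B).map_mulVec M u i :
          (fun i => algebraMap ℝ B (M.mulVec u i)) = (M.map (algebraMap ℝ B)).mulVec
            (fun i => algebraMap ℝ B (u i)))
      rw [← h2, ← h2, h1]
      simp
    rw [hlim']
    have hv : Tendsto (fun t => standardVertex (ζ t (T.walk j γ)) a) (comap Subtype.val (𝓝 0))
        (𝓝 (standardVertex (algebraMap ℝ B (z (T.walk j γ))) a)) :=
      ((continuous_standardVertex a).tendsto _).comp ((tendsto_pi_nhds.1 hlim) _)
    have hcont : Continuous fun y : Matrix (Fin 2) (Fin 2) B × (Fin 2 → B) =>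
        algebraMap ℝ B (c * d) • ((A j)⁻¹.map (algebraMap ℝ B)).mulVec (y.1.mulVec y.2) :=
      (continuous_const_smul _).comp
        (continuous_const.matrix_mulVec (continuous_fst.matrix_mulVec continuous_snd))
    have := (hcont.tendsto _).comp ((hdlim j γ).prodMk_nhds hv)
    refine this.congr fun t => ?_
    simp only [Function.comp, Realization.developedVertex, standardRealization_develop]
    rfl
  · intro j γ hγ
    obtain ⟨c, hc⟩ := hdev' j γ
    refine ⟨fun _ => (hmap c).unit, ?_⟩
    have hcont : Continuous fun y : Matrix (Fin 2) (Fin 2) B =>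
        algebraMap ℝ B c • ((A j)⁻¹.map (algebraMap ℝ B) * y * (A j).map (algebraMap ℝ B)) :=
      (continuous_const_smul _).comp
        ((continuous_const.matrix_mul continuous_id).matrix_mul continuous_const)
    have hlim' : (F.develop j γ).map (algebraMap ℝ B) = algebraMap ℝ B c •
        ((A j)⁻¹.map (algebraMap ℝ B) * (T.standardDevelop z j γ).map (algebraMap ℝ B) *
          (A j).map (algebraMap ℝ B)) := by
      have : (A j)⁻¹.map (algebraMap ℝ B) * (T.standardDevelop z j γ).map (algebraMap ℝ B) *
          (A j).map (algebraMap ℝ B) =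
          ((A j)⁻¹ * T.standardDevelop z j γ * A j).map (algebraMap ℝ B) := by
        rw [Matrix.map_mul, Matrix.map_mul]
      rw [hc, hγ, this]
      ext
      simp only [Matrix.map_apply, Matrix.smul_apply, smul_eq_mul, map_mul]
    have hinv : ((A j)⁻¹.map (algebraMap ℝ B))⁻¹ = (A j).map (algebraMap ℝ B) := by
      refine Matrix.inv_eq_right_inv ?_
      rw [← Matrix.map_mul, Matrix.nonsing_inv_mul _ (hAu j)]
      simp
    rw [hlim']
    refine ((hcont.tendsto _).comp (hdlim j γ)).congr fun t => ?_
    simp only [Function.comp, standardRealization_develop, hinv]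
    rfl

end Collapse

end IdealTriangulation

/-! ## Analytic curves through smooth points -/

section Smooth

variable {E : Type*} [NormedAddCommGroup E] [NormedSpace ℝ E]

/-- Tangent vectors at a smooth point lie in the image of the derivative of a local
parametrization. -/
theorem IsTangentVector.mem_range_fderiv {D : Set E} {z v : E} (hv : IsTangentVector D z v)
    {d : ℕ} {φ : (Fin d → ℝ) → E} (hφ : DifferentiableAt ℝ φ 0) (h0 : φ 0 = z)
    (hinj : Function.Injective (fderiv ℝ φ 0)) (hmap : map φ (𝓝 0) = 𝓝[D] z) :
    v ∈ LinearMap.range (fderiv ℝ φ 0).toLinearMap := by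
  obtain ⟨γ, hγ0, hγ, hγD⟩ := hv
  set L := fderiv ℝ φ 0 with hL
  obtain ⟨K, hK, hanti⟩ := (L : (Fin d → ℝ) →ₗ[ℝ] E).exists_antilipschitzWith
    (LinearMap.ker_eq_bot.2 hinj)
  have hK' : (0 : ℝ) < K := hK
  have hbound : ∀ p, ‖p‖ ≤ K * ‖L p‖ := fun p => by
    simpa using hanti.le_mul_dist p 0
  have hclosed : IsClosed (LinearMap.range L.toLinearMap : Set E) :=
    Submodule.closed_of_finiteDimensional _
  -- The range is finite-dimensional, hence closed, so approximating `v` within `ε` suffices.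
  rw [← SetLike.mem_coe, ← hclosed.closure_eq, Metric.mem_closure_iff]
  intro ε hε
  -- `e` is the linearization error for `φ` and for the curve: `K * e ≤ 1 / 2` absorbs the error in
  -- the bound on `‖p‖`, and the last inequality is the final estimate.
  obtain ⟨e, he, heK, he1, heε⟩ : ∃ e : ℝ, 0 < e ∧ K * e ≤ 1 / 2 ∧ e ≤ 1 ∧
      e + e * (2 * K * (‖v‖ + 1)) < ε := by
    have hM : 0 < 1 + 2 * K * (‖v‖ + 1) := by positivity
    refine ⟨min (min (1 / (2 * K)) 1) (ε / (2 * (1 + 2 * K * (‖v‖ + 1)))), by positivity,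
      ?_, ?_, ?_⟩
    · calc K * min (min (1 / (2 * (K : ℝ))) 1) _ ≤ K * (1 / (2 * K)) := by
            gcongr; exact (min_le_left _ _).trans (min_le_left _ _)
        _ = 1 / 2 := by field_simp
    · exact (min_le_left _ _).trans (min_le_right _ _)
    · set e := min (min (1 / (2 * (K : ℝ))) 1) (ε / (2 * (1 + 2 * K * (‖v‖ + 1)))) with he
      have : e ≤ ε / (2 * (1 + 2 * K * (‖v‖ + 1))) := min_le_right _ _
      calc e + e * (2 * K * (‖v‖ + 1)) = e * (1 + 2 * K * (‖v‖ + 1)) := by ring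
        _ ≤ ε / (2 * (1 + 2 * K * (‖v‖ + 1))) * (1 + 2 * K * (‖v‖ + 1)) := by gcongr
        _ = ε / 2 := by field_simp
        _ < ε := by linarith
  have hU : ∀ᶠ p in 𝓝 (0 : Fin d → ℝ), ‖φ p - z - L p‖ ≤ e * ‖p‖ := by
    have := (hasFDerivAt_iff_isLittleO_nhds_zero.1 hφ.hasFDerivAt).def he
    filter_upwards [this] with p hp
    simpa [h0] using hp
  -- The equality of filters, not mere injectivity, ensures that points of `D` near `z` come from
  -- parameters near `0`. No continuity of the choice of `p` is needed.
  have hV : ∀ᶠ y in 𝓝[D] z, ∃ p, φ p = y ∧ ‖φ p - z - L p‖ ≤ e * ‖p‖ := by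
    rw [← hmap, eventually_map]
    filter_upwards [hU] with p hp using ⟨p, rfl, hp⟩
  have hγt : Tendsto γ (𝓝 0) (𝓝[D] z) :=
    tendsto_nhdsWithin_iff.2 ⟨hγ0 ▸ hγ.continuousAt.tendsto, hγD⟩
  have hγe : ∀ᶠ s in 𝓝 (0 : ℝ), ‖γ s - z - s • v‖ ≤ e * ‖s‖ := by
    have := (hasDerivAt_iff_isLittleO_nhds_zero.1 hγ).def he
    filter_upwards [this] with p hp
    simpa [hγ0] using hp
  obtain ⟨s, ⟨⟨p, hp, hpe⟩, hs⟩, hs0⟩ :=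
    (((hγt.eventually hV).and hγe).filter_mono nhdsWithin_le_nhds |>.and
      (self_mem_nhdsWithin (a := (0 : ℝ)) (s := {0}ᶜ))).exists
  have hs0' : s ≠ 0 := hs0
  have hsn : 0 < ‖s‖ := norm_pos_iff.2 hs0'
  rw [hp] at hpe
  have h1 : ‖γ s - z‖ ≤ ‖s‖ * (‖v‖ + e) := by
    calc ‖γ s - z‖ = ‖(γ s - z - s • v) + s • v‖ := by rw [sub_add_cancel]
      _ ≤ ‖γ s - z - s • v‖ + ‖s • v‖ := norm_add_le _ _
      _ ≤ e * ‖s‖ + ‖s‖ * ‖v‖ := by rw [norm_smul]; gcongr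
      _ = _ := by ring
  have h2 : ‖p‖ ≤ 2 * K * ‖γ s - z‖ := by
    have h3 : ‖L p‖ ≤ ‖γ s - z‖ + e * ‖p‖ := by
      calc ‖L p‖ = ‖(γ s - z) - (γ s - z - L p)‖ := by rw [sub_sub_cancel]
        _ ≤ ‖γ s - z‖ + ‖γ s - z - L p‖ := norm_sub_le _ _
        _ ≤ _ := by gcongr
    have h4 : ‖p‖ ≤ K * ‖γ s - z‖ + K * e * ‖p‖ := by
      calc ‖p‖ ≤ K * ‖L p‖ := hbound p
        _ ≤ K * (‖γ s - z‖ + e * ‖p‖) := by gcongr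
        _ = _ := by ring
    have h5 : K * e * ‖p‖ ≤ 1 / 2 * ‖p‖ := by gcongr
    linarith
  -- Since `γ s = φ p`, both `s • v` and `L p` approximate `γ s - z`; dividing by `s` approximates
  -- `v`.
  refine ⟨L (s⁻¹ • p), ⟨_, rfl⟩, ?_⟩
  have h6 : ‖s • v - L p‖ ≤ ‖s‖ * (e + e * (2 * K * (‖v‖ + 1))) := by
    calc ‖s • v - L p‖ = ‖(γ s - z - L p) - (γ s - z - s • v)‖ := by congr 1; abel
      _ ≤ ‖γ s - z - L p‖ + ‖γ s - z - s • v‖ := norm_sub_le _ _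
      _ ≤ e * (2 * K * (‖s‖ * (‖v‖ + 1))) + e * ‖s‖ := by
          refine add_le_add (hpe.trans ?_) hs
          gcongr
          refine h2.trans ?_
          gcongr
          refine h1.trans ?_
          gcongr
      _ = _ := by ring
  have h7 : v - L (s⁻¹ • p) = s⁻¹ • (s • v - L p) := by
    rw [map_smul, smul_sub, inv_smul_smul₀ hs0']
  rw [dist_eq_norm, h7, norm_smul, norm_inv, inv_mul_lt_iff₀ hsn]
  exact h6.trans_lt (mul_lt_mul_of_pos_left heε hsn)

theorem IsSmoothPoint.exists_analytic_curve {D : Set E} {z v : E} (hD : IsSmoothPoint D z)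
    (hv : IsTangentVector D z v) :
    ∃ c : ℝ → E, AnalyticAt ℝ c 0 ∧ c 0 = z ∧ HasDerivAt c v 0 ∧ ∀ᶠ s in 𝓝 0, c s ∈ D := by
  obtain ⟨d, φ, hφ, h0, hinj, hmap⟩ := hD
  obtain ⟨u, hu⟩ := hv.mem_range_fderiv hφ.differentiableAt h0 hinj hmap
  have hline : AnalyticAt ℝ (fun s : ℝ => s • u) 0 := by fun_prop
  have hline' : HasDerivAt (fun s : ℝ => s • u) u 0 := by
    simpa using (hasDerivAt_id (0 : ℝ)).smul_const u
  have hev : ∀ᶠ p in 𝓝 0, φ p ∈ D := by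
    rw [← eventually_map (P := fun y => y ∈ D), hmap]
    exact self_mem_nhdsWithin
  have hz : (fun s : ℝ => s • u) 0 = 0 := zero_smul ℝ u
  refine ⟨fun s => φ (s • u), ?_, by simp [h0], ?_, ?_⟩
  · exact AnalyticAt.fun_comp (by rwa [zero_smul]) hline
  · have h1 : HasFDerivAt φ (fderiv ℝ φ 0) ((fun s : ℝ => s • u) 0) := by
      rw [hz]; exact hφ.differentiableAt.hasFDerivAt
    have := h1.comp_hasDerivAt (0 : ℝ) hline'
    rwa [show (fderiv ℝ φ 0) u = v from hu] at this
  · have h2 : Tendsto (fun s : ℝ => s • u) (𝓝 0) (𝓝 0) := by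
      simpa using hline.continuousAt.tendsto
    exact h2.eventually hev

end Smooth

/-! ## Complexification of analytic functions -/

theorem AnalyticAt.exists_complexification {c : ℝ → ℝ} (hc : AnalyticAt ℝ c 0) :
    ∃ C : ℂ → ℂ, AnalyticAt ℂ C 0 ∧ ∀ᶠ s : ℝ in 𝓝 0, C s = c s := by
  obtain ⟨p, hp⟩ := hc
  rw [hasFPowerSeriesAt_iff] at hp
  simp only [zero_add, smul_eq_mul] at hp
  refine ⟨fun w => ∑' n, w ^ n * (p.coeff n : ℂ), ?_, ?_⟩
  · refine ⟨FormalMultilinearSeries.ofScalars ℂ (fun n => (p.coeff n : ℂ)), ?_⟩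
    rw [hasFPowerSeriesAt_iff]
    obtain ⟨ε, hε, h⟩ := Metric.eventually_nhds_iff.1 hp
    -- Absolute convergence at the real point `ε / 2` dominates the same series on the complex disc
    -- of that radius.
    have hs := (h (y := ε / 2) (by simp [abs_of_pos hε]; linarith)).summable.norm
    filter_upwards [Metric.ball_mem_nhds (0 : ℂ) (half_pos hε)] with w hw
    rw [zero_add]
    simp only [FormalMultilinearSeries.coeff_ofScalars, smul_eq_mul]
    refine Summable.hasSum (hs.of_norm_bounded fun n => ?_)
    rw [norm_mul, norm_mul, norm_pow, norm_pow, Complex.norm_real]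
    have : ‖w‖ ≤ ‖ε / 2‖ := by
      rw [Real.norm_of_nonneg (half_pos hε).le]
      exact (mem_ball_zero_iff.1 hw).le
    gcongr
  · filter_upwards [hp] with s hs
    rw [← hs.tsum_eq, Complex.ofReal_tsum]
    simp

theorem HasDerivAt.complexification {c : ℝ → ℝ} {C : ℂ → ℂ} {v : ℝ} (hC : AnalyticAt ℂ C 0)
    (h : ∀ᶠ s : ℝ in 𝓝 0, C s = c s) (hv : HasDerivAt c v 0) : HasDerivAt C v 0 := by
  have h1 : HasDerivAt C (_root_.deriv C 0) ((0 : ℝ) : ℂ) := by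
    simpa using hC.differentiableAt.hasDerivAt
  have h2 : HasDerivAt (fun s : ℝ => (c s : ℂ)) (v : ℂ) 0 := hv.ofReal_comp
  have h3 := h1.comp_ofReal.unique (h2.congr_of_eventuallyEq h)
  simpa [h3] using h1

/-! ## Bounded reparametrizations of the line -/

/-- The curves are controlled only near `0`; composing with such an `η` defines them for all `t`
without changing their velocity at `0`. -/
theorem exists_bounded_reparametrization {δ : ℝ} (hδ : 0 < δ) :
    ∃ η : ℝ → ℝ, ContDiff ℝ ∞ η ∧ η 0 = 0 ∧ HasDerivAt η 1 0 ∧ (∀ t, |η t| < δ) ∧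
      ∀ t, 0 < t → 0 < η t := by
  have hpos : ∀ t : ℝ, 0 < δ ^ 2 + t ^ 2 := fun t => by positivity
  refine ⟨fun t => δ ^ 2 * t / (δ ^ 2 + t ^ 2), ?_, by simp, ?_, ?_, ?_⟩
  · exact ContDiff.div (by fun_prop) (by fun_prop) fun t => (hpos t).ne'
  · have h1 : HasDerivAt (fun t : ℝ => δ ^ 2 * t) (δ ^ 2) 0 := by
      simpa using (hasDerivAt_id (0 : ℝ)).const_mul (δ ^ 2)
    have h2 : HasDerivAt (fun t : ℝ => δ ^ 2 + t ^ 2) 0 0 := by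
      simpa using (hasDerivAt_pow 2 (0 : ℝ)).const_add (δ ^ 2)
    have := h1.div h2 (hpos 0).ne'
    rwa [show (δ ^ 2 * (δ ^ 2 + 0 ^ 2) - δ ^ 2 * 0 * 0) / (δ ^ 2 + 0 ^ 2) ^ 2 = 1 by
      rw [div_eq_one_iff_eq (pow_ne_zero 2 (hpos 0).ne')]; ring] at this
  · intro t
    rw [abs_div, abs_mul, abs_of_pos (hpos t), abs_of_nonneg (sq_nonneg δ), div_lt_iff₀ (hpos t)]
    have h1 : δ * |t| < δ ^ 2 + t ^ 2 := by
      rw [← sq_abs t]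
      nlinarith [sq_nonneg (δ - |t|), abs_nonneg t, sq_nonneg (δ + |t|), sq_pos_of_pos hδ,
        sq_nonneg (|t|)]
    nlinarith
  · intro t ht
    have := hpos t
    positivity

theorem HasDerivAt.eventually_pos {f : ℝ → ℝ} {v : ℝ} (hf : HasDerivAt f v 0) (h0 : f 0 = 0)
    (hv : 0 < v) : ∀ᶠ s in 𝓝[>] 0, 0 < f s := by
  have h := (hasDerivAt_iff_tendsto_slope.1 hf).mono_left
    (nhdsWithin_mono (0 : ℝ) (fun s (hs : s ∈ Set.Ioi 0) => (ne_of_gt hs : s ≠ 0)))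
  filter_upwards [h.eventually (lt_mem_nhds hv), self_mem_nhdsWithin] with s hs hs0
  have hs0' : (0 : ℝ) < s := hs0
  rw [slope_def_field, h0, sub_zero, sub_zero] at hs
  exact (div_pos_iff_of_pos_right hs0').1 hs

/-! ## Edge parameters -/

section EdgeParameter

/-- Units are required because `Ring.inverse` is zero at non-units, which a homomorphism may send to
units. -/
theorem edgeParameter_map {R K : Type} [CommRing R] [Field K] (g : R →+* K) {z : R}
    (hz : IsUnit z) (hz' : IsUnit (1 - z)) (a b : Fin 4) :
    g (edgeParameter z a b) = edgeParameter (g z) a b := by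
  have h : ∀ u : R, IsUnit u → g (Ring.inverse u) = Ring.inverse (g u) := fun u hu => by
    rw [Ring.inverse_eq_inv']
    refine eq_inv_of_mul_eq_one_left ?_
    rw [← map_mul, Ring.inverse_mul_cancel u hu, map_one]
  unfold edgeParameter
  split_ifs
  · rfl
  · rw [h _ hz', map_sub, map_one]
  · rw [map_mul, h _ hz, map_sub, map_one]

theorem edgeParameter_ne_zero {K : Type} [Field K] {z : K} (hz : z ≠ 0) (hz' : 1 - z ≠ 0)
    (a b : Fin 4) : edgeParameter z a b ≠ 0 := by
  have h : z - 1 ≠ 0 := fun h => hz' (by rw [← neg_sub, h, neg_zero])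
  unfold edgeParameter
  simp only [Ring.inverse_eq_inv']
  split_ifs
  · exact hz
  · exact inv_ne_zero hz'
  · exact mul_ne_zero h (inv_ne_zero hz)

theorem edgeParameter_im_pos {z : ℂ} (hz : 0 < z.im) (a b : Fin 4) :
    0 < (edgeParameter z a b).im := by
  have h0 : z ≠ 0 := by rintro rfl; simp at hz
  have h1 : 1 - z ≠ 0 := by
    intro h
    have := congrArg Complex.im h
    simp at this
    exact hz.ne' this
  unfold edgeParameter
  simp only [Ring.inverse_eq_inv']
  split_ifs
  · exact hz
  · rw [Complex.inv_im]
    have := Complex.normSq_pos.2 h1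
    simp only [Complex.sub_im, Complex.one_im]
    exact div_pos (by linarith) this
  · have := Complex.normSq_pos.2 h0
    rw [sub_mul, mul_inv_cancel₀ h0, one_mul, Complex.sub_im, Complex.inv_im, Complex.one_im,
      neg_div, zero_sub, neg_neg]
    exact div_pos hz this

theorem analyticAt_edgeParameter {C : ℂ → ℂ} {w : ℂ} (hC : AnalyticAt ℂ C w) (h0 : C w ≠ 0)
    (h1 : 1 - C w ≠ 0) (a b : Fin 4) : AnalyticAt ℂ (fun y => edgeParameter (C y) a b) w := by
  unfold edgeParameter
  simp only [Ring.inverse_eq_inv']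
  split_ifs
  · exact hC
  · exact (analyticAt_const.sub hC).inv h1
  · exact (hC.sub analyticAt_const).mul (hC.inv h0)

/-- All edge parameters are, up to a fixed sign, products of powers of `x` and `1 - x`, so the signs
of these two determine theirs. -/
theorem edgeParameter_neg_iff {x y : ℝ} (h0 : 0 < x * y) (h1 : 0 < (1 - x) * (1 - y))
    (a b : Fin 4) : edgeParameter x a b < 0 ↔ edgeParameter y a b < 0 := by
  have key : ∀ {x y : ℝ}, 0 < x * y → (x < 0 ↔ y < 0) := fun h =>
    ⟨fun hx => neg_of_mul_pos_right h hx.le, fun hy => neg_of_mul_pos_left h hy.le⟩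
  unfold edgeParameter
  simp only [Ring.inverse_eq_inv']
  split_ifs
  · exact key h0
  · exact key (by rw [← mul_inv]; exact inv_pos.2 h1)
  · refine key ?_
    have : (x - 1) * x⁻¹ * ((y - 1) * y⁻¹) = (1 - x) * (1 - y) * (x * y)⁻¹ := by
      rw [mul_inv]; ring
    rw [this]
    exact mul_pos h1 (inv_pos.2 h0)

end EdgeParameter

/-! ## Pseudo-complex numbers -/

section PseudoComplex

instance : IsTopologicalRing PseudoComplex where
  continuous_add := by
    have h : Continuous fun z : PseudoComplex => (z.re, z.im) := continuous_induced_dom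
    have h1 := continuous_fst.comp h
    have h2 := continuous_snd.comp h
    simp only [Function.comp_def] at h1 h2
    refine continuous_induced_rng.2 ?_
    simp only [Function.comp_def, QuadraticAlgebra.re_add, QuadraticAlgebra.im_add]
    fun_prop
  continuous_mul := by
    have h : Continuous fun z : PseudoComplex => (z.re, z.im) := continuous_induced_dom
    have h1 := continuous_fst.comp h
    have h2 := continuous_snd.comp h
    simp only [Function.comp_def] at h1 h2
    refine continuous_induced_rng.2 ?_
    simp only [Function.comp_def, QuadraticAlgebra.re_mul, QuadraticAlgebra.im_mul]
    fun_prop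
  continuous_neg := by
    have h : Continuous fun z : PseudoComplex => (z.re, z.im) := continuous_induced_dom
    have h1 := continuous_fst.comp h
    have h2 := continuous_snd.comp h
    simp only [Function.comp_def] at h1 h2
    refine continuous_induced_rng.2 ?_
    simp only [Function.comp_def, QuadraticAlgebra.re_neg, QuadraticAlgebra.im_neg]
    fun_prop

namespace PseudoComplex

/-- The ring homomorphism `a + bτ ↦ a + b`. -/
def left : PseudoComplex →+* ℝ where
  toFun z := z.re + z.im
  map_one' := add_zero 1
  map_zero' := by simp
  map_add' z w := by simp; ring
  map_mul' z w := by simp; ring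

/-- The ring homomorphism `a + bτ ↦ a - b`. -/
def right : PseudoComplex →+* ℝ where
  toFun z := z.re - z.im
  map_one' := sub_zero 1
  map_zero' := by simp
  map_add' z w := by simp; ring
  map_mul' z w := by simp; ring

theorem left_apply (z : PseudoComplex) : left z = z.re + z.im := rfl

theorem right_apply (z : PseudoComplex) : right z = z.re - z.im := rfl

theorem ext_left_right {z w : PseudoComplex} (h : left z = left w) (h' : right z = right w) :
    z = w := by
  rw [left_apply, left_apply] at h
  rw [right_apply, right_apply] at h'
  exact QuadraticAlgebra.ext (by linarith) (by linarith)

/-- Conjugation exchanges the two factors, so `|z|²` is the product of the two components. -/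
theorem spacelike {z : PseudoComplex} (h : 0 < left z * right z) : Spacelike z := by
  refine ⟨left z * right z, h, ?_⟩
  refine QuadraticAlgebra.ext ?_ ?_
  · simp [left_apply, right_apply]; ring
  · simp; ring

/-- The pseudo-complex number with given images under `left` and `right`. -/
def ofPair (x y : ℝ) : PseudoComplex := ⟨(x + y) / 2, (x - y) / 2⟩

theorem left_ofPair (x y : ℝ) : left (ofPair x y) = x := by
  simp only [left_apply, ofPair]; ring

theorem right_ofPair (x y : ℝ) : right (ofPair x y) = y := by
  simp only [right_apply, ofPair]; ring

end PseudoComplex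

namespace IdealTriangulation

variable {N : ℕ} {T : IdealTriangulation N}

open PseudoComplex in
/-- Two nearby real solutions of Thurston's equations give a pseudo-complex solution. -/
theorem ofPair_mem_thurstonSolutions {x y : Fin N → ℝ} (hx : x ∈ T.realDeformationVariety)
    (hy : y ∈ T.realDeformationVariety) (h0 : ∀ j, 0 < x j * y j)
    (h1 : ∀ j, 0 < (1 - x j) * (1 - y j)) :
    (fun j => ofPair (x j) (y j)) ∈ T.thurstonSolutions pseudoAngle := by
  have s0 : ∀ j, Spacelike (ofPair (x j) (y j)) := fun j =>
    spacelike (by rw [left_ofPair, right_ofPair]; exact h0 j)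
  have s1 : ∀ j, Spacelike (1 - ofPair (x j) (y j)) := fun j =>
    spacelike (by simpa only [map_sub, map_one, left_ofPair, right_ofPair] using h1 j)
  have hl : ∀ j a b, left (edgeParameter (ofPair (x j) (y j)) a b) = edgeParameter (x j) a b :=
    fun j a b => by rw [edgeParameter_map left (s0 j).isUnit (s1 j).isUnit, left_ofPair]
  have hr : ∀ j a b, right (edgeParameter (ofPair (x j) (y j)) a b) = edgeParameter (y j) a b :=
    fun j a b => by rw [edgeParameter_map right (s0 j).isUnit (s1 j).isUnit, right_ofPair]
  refine ⟨fun j => ⟨s0 j, s1 j⟩, fun j π hπ => ⟨?_, ?_⟩⟩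
  · apply ext_left_right
    · rw [map_prod, map_one]
      exact (Finset.prod_congr rfl fun i _ => hl _ _ _).trans (hx.2 j π hπ).1
    · rw [map_prod, map_one]
      exact (Finset.prod_congr rfl fun i _ => hr _ _ _).trans (hy.2 j π hπ).1
  · rw [← (hx.2 j π hπ).2]
    refine Finset.sum_congr rfl fun i _ => ?_
    generalize (T.around (j, π) i).1 = k, (T.around (j, π) i).2 0 = a,
      (T.around (j, π) i).2 1 = b
    have hk := edgeParameter_neg_iff (h0 k) (h1 k) a b
    have e1 := hl k a b
    have e2 := hr k a b
    rw [left_apply] at e1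
    rw [right_apply] at e2
    unfold pseudoAngle realAngle
    -- The real part is the mean of the two components, which have the same sign.
    refine if_congr ⟨fun h => ?_, fun h => ?_⟩ rfl rfl
    · by_contra hcon
      have := mt hk.2 hcon
      linarith
    · have := hk.1 h
      linarith

end IdealTriangulation

end PseudoComplex

/-! ## Complex solutions of Thurston's equations -/

section Complex

theorem Complex.spacelike {z : ℂ} (h : z ≠ 0) : Spacelike z :=
  ⟨Complex.normSq z, Complex.normSq_pos.2 h, Complex.mul_conj z⟩

/-- `Complex.arg` jumps across the negative axis, but its limit from the upper half-plane is `π`;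
positivity of `im` selects that side. -/
theorem tendsto_arg_of_im_pos {X : Type*} {l : Filter X} {w : X → ℂ} {x : ℝ} (hx : x ≠ 0)
    (hw : Tendsto w l (𝓝 (x : ℂ))) (him : ∀ᶠ s in l, 0 < (w s).im) :
    Tendsto (fun s => Complex.arg (w s)) l (𝓝 (realAngle x)) := by
  unfold realAngle
  split_ifs with h
  · refine (Complex.tendsto_arg_nhdsWithin_im_nonneg_of_re_neg_of_im_zero (z := (x : ℂ))
      (by simpa using h) (by simp)).comp (tendsto_nhdsWithin_iff.2 ⟨hw, ?_⟩)
    filter_upwards [him] with s hs using hs.le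
  · have hx' : 0 < x := lt_of_le_of_ne (not_lt.1 h) hx.symm
    have := (Complex.continuousAt_arg (x := (x : ℂ)) (Or.inl (by simpa using hx'))).tendsto.comp hw
    rwa [Complex.arg_ofReal_of_nonneg hx'.le] at this

/-- The total argument is `2πk` for an integer `k`, and the strict bound leaves only `0 < k < 2`. -/
theorem sum_arg_eq_two_pi {n : ℕ} {w : ℕ → ℂ}
    (hprod : ∏ i ∈ Finset.range n, w i = 1)
    (hsum : |∑ i ∈ Finset.range n, (w i).arg - 2 * Real.pi| < 2 * Real.pi) :
    ∑ i ∈ Finset.range n, (w i).arg = 2 * Real.pi := by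
  have h1 : Complex.exp (((∑ i ∈ Finset.range n, (w i).arg : ℝ) : ℂ) * Complex.I) = 1 := by
    have h2 : ∏ i ∈ Finset.range n, ((‖w i‖ : ℝ) : ℂ) = 1 := by
      rw [← Complex.ofReal_prod, ← norm_prod, hprod, norm_one, Complex.ofReal_one]
    rw [Complex.ofReal_sum, Finset.sum_mul, Complex.exp_sum, ← hprod,
      ← one_mul (∏ i ∈ Finset.range n, Complex.exp _), ← h2, ← Finset.prod_mul_distrib]
    exact Finset.prod_congr rfl fun i _ => Complex.norm_mul_exp_arg_mul_I _
  obtain ⟨k, hk⟩ := Complex.exp_eq_one_iff.1 h1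
  have h3 : ∑ i ∈ Finset.range n, (w i).arg = k * (2 * Real.pi) := by
    have := congrArg Complex.im hk
    simpa using this
  rw [h3] at hsum ⊢
  have hpi : 0 < 2 * Real.pi := by positivity
  rw [abs_lt] at hsum
  have l1 : (0 : ℝ) < k := by
    by_contra! h
    nlinarith
  have l2 : (k : ℝ) < 2 := by
    by_contra! h
    nlinarith
  have : k = 1 := by
    have l1' : 0 < k := by exact_mod_cast l1
    have l2' : k < 2 := by exact_mod_cast l2
    omega
  rw [this]; simp

namespace IdealTriangulation

variable {N : ℕ} {T : IdealTriangulation N}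

/-- The complexification of a curve of real solutions consists of solutions of Thurston's
equations over the complex numbers. -/
theorem eventually_mem_thurstonSolutions_arg {z v : Fin N → ℝ}
    (hz : z ∈ T.realDeformationVariety) (hpos : ∀ j, 0 < v j) {c : ℝ → Fin N → ℝ}
    (hc : ∀ᶠ s in 𝓝 0, c s ∈ T.realDeformationVariety) {C : Fin N → ℂ → ℂ}
    (hC : ∀ j, AnalyticAt ℂ (C j) 0) (hCc : ∀ j, ∀ᶠ s : ℝ in 𝓝 0, C j s = c s j)
    (hC0 : ∀ j, C j 0 = z j) (hC' : ∀ j, HasDerivAt (C j) (v j) 0) :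
    ∀ᶠ s : ℝ in 𝓝[>] 0, (fun j => C j (Complex.I * s)) ∈ T.thurstonSolutions Complex.arg ∧
      ∀ j, 0 < (C j (Complex.I * s)).im := by
  have hz0 : ∀ j, z j ≠ 0 := fun j => (hz.1 j).1.isUnit.ne_zero
  have hz1 : ∀ j, 1 - z j ≠ 0 := fun j => (hz.1 j).2.isUnit.ne_zero
  have hI : Tendsto (fun s : ℝ => Complex.I * s) (𝓝[>] 0) (𝓝 0) := by
    have : Continuous fun s : ℝ => Complex.I * s := by fun_prop
    simpa using (this.tendsto 0).mono_left nhdsWithin_le_nhds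
  have him : ∀ᶠ s : ℝ in 𝓝[>] 0, ∀ j, 0 < (C j (Complex.I * s)).im := by
    refine eventually_all.2 fun j => ?_
    have hI' : HasDerivAt (fun w : ℂ => Complex.I * w) Complex.I ((0 : ℝ) : ℂ) := by
      simpa using (hasDerivAt_id ((0 : ℝ) : ℂ)).const_mul Complex.I
    have h1 : HasDerivAt (C j) (v j) (Complex.I * ((0 : ℝ) : ℂ)) := by simpa using hC' j
    -- The imaginary part of `C j` is the real part of `-i C j`, whose derivative along `i s` is `v
    -- j > 0`.
    have h2 : HasDerivAt (fun w : ℂ => -Complex.I * C j (Complex.I * w))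
        (-Complex.I * (v j * Complex.I)) ((0 : ℝ) : ℂ) :=
      (h1.comp ((0 : ℝ) : ℂ) hI').const_mul _
    have h3 := h2.real_of_complex
    have h4 : (-Complex.I * (v j * Complex.I)).re = v j := by simp
    rw [h4] at h3
    have h5 := h3.eventually_pos (by simp [hC0]) (hpos j)
    filter_upwards [h5] with s hs
    simpa using hs
  have hedge : ∀ j a b, AnalyticAt ℂ (fun w => edgeParameter (C j w) a b) 0 := fun j a b =>
    analyticAt_edgeParameter (hC j) (by rw [hC0]; exact_mod_cast hz0 j)
      (by rw [hC0]; exact_mod_cast hz1 j) a b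
  have hreal : ∀ (x : ℝ) (a b : Fin 4), x ≠ 0 → 1 - x ≠ 0 →
      edgeParameter (x : ℂ) a b = (edgeParameter x a b : ℝ) := fun x a b h0 h1 =>
    (edgeParameter_map Complex.ofRealHom (isUnit_iff_ne_zero.2 h0) (isUnit_iff_ne_zero.2 h1)
      a b).symm
  have hprod : ∀ᶠ w : ℂ in 𝓝 0, ∀ (j : Fin N) (π : Equiv.Perm (Fin 4)),
      Equiv.Perm.sign π = 1 → ∏ i ∈ Finset.range (T.valence (j, π)),
        edgeParameter (C (T.around (j, π) i).1 w)
          ((T.around (j, π) i).2 0) ((T.around (j, π) i).2 1) = 1 := by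
    refine eventually_all.2 fun j => eventually_all.2 fun π => eventually_imp_distrib_left.2
      fun hπ => ?_
    have han : AnalyticAt ℂ (fun w => ∏ i ∈ Finset.range (T.valence (j, π)),
        edgeParameter (C (T.around (j, π) i).1 w)
          ((T.around (j, π) i).2 0) ((T.around (j, π) i).2 1)) 0 :=
      Finset.analyticAt_fun_prod _ fun i _ => hedge _ _ _
    -- Identity theorem: the nonzero reals accumulate at `0`, and there the product is the one for
    -- the real solution `c s`.
    refine (han.frequently_eq_iff_eventually_eq analyticAt_const).1 ?_
    have hof : Tendsto (fun s : ℝ => (s : ℂ)) (𝓝[≠] 0) (𝓝[≠] 0) := by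
      refine tendsto_nhdsWithin_iff.2 ⟨?_, ?_⟩
      · have := (Complex.continuous_ofReal.tendsto 0).mono_left
          (nhdsWithin_le_nhds (s := {(0 : ℝ)}ᶜ))
        simpa using this
      · filter_upwards [self_mem_nhdsWithin] with s hs
        exact Complex.ofReal_ne_zero.2 hs
    refine hof.frequently (Eventually.frequently ?_)
    filter_upwards [nhdsWithin_le_nhds hc, nhdsWithin_le_nhds (eventually_all.2 hCc)]
      with s hs hs'
    simp only [hs']
    have h1 := congrArg (fun x : ℝ => (x : ℂ)) (hs.2 j π hπ).1
    rw [Complex.ofReal_prod, Complex.ofReal_one] at h1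
    rw [← h1]
    exact Finset.prod_congr rfl fun i _ =>
      hreal _ _ _ (hs.1 _).1.isUnit.ne_zero (hs.1 _).2.isUnit.ne_zero
  have hangle : ∀ᶠ s : ℝ in 𝓝[>] 0, ∀ (j : Fin N) (π : Equiv.Perm (Fin 4)),
      Equiv.Perm.sign π = 1 → |∑ i ∈ Finset.range (T.valence (j, π)),
        (edgeParameter (C (T.around (j, π) i).1 (Complex.I * s))
          ((T.around (j, π) i).2 0) ((T.around (j, π) i).2 1)).arg - 2 * Real.pi|
        < 2 * Real.pi := by
    refine eventually_all.2 fun j => eventually_all.2 fun π => eventually_imp_distrib_left.2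
      fun hπ => ?_
    have hlim : Tendsto (fun s : ℝ => ∑ i ∈ Finset.range (T.valence (j, π)),
        (edgeParameter (C (T.around (j, π) i).1 (Complex.I * s))
          ((T.around (j, π) i).2 0) ((T.around (j, π) i).2 1)).arg) (𝓝[>] 0)
        (𝓝 (2 * Real.pi)) := by
      rw [← (hz.2 j π hπ).2]
      refine tendsto_finsetSum _ fun i _ => tendsto_arg_of_im_pos
        (edgeParameter_ne_zero (hz0 _) (hz1 _) _ _) ?_ ?_
      · have := (hedge (T.around (j, π) i).1 ((T.around (j, π) i).2 0)
          ((T.around (j, π) i).2 1)).continuousAt.tendsto.comp hI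
        rwa [hC0, hreal _ _ _ (hz0 _) (hz1 _)] at this
      · filter_upwards [him] with s hs using edgeParameter_im_pos (hs _) _ _
    filter_upwards [hlim.eventually (Metric.ball_mem_nhds _ Real.two_pi_pos)] with s hs
    rwa [← Real.dist_eq]
  filter_upwards [him, hI.eventually hprod, hangle] with s h1 h2 h3
  have n0 : ∀ j, C j (Complex.I * s) ≠ 0 := fun j h => by
    have := h1 j
    rw [h] at this
    simp at this
  have n1 : ∀ j, 1 - C j (Complex.I * s) ≠ 0 := fun j h => by
    have := h1 j
    rw [← sub_eq_zero.1 h] at this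
    simp at this
  exact ⟨⟨fun j => ⟨Complex.spacelike (n0 j), Complex.spacelike (n1 j)⟩, fun j π hπ =>
    ⟨h2 j π hπ, sum_arg_eq_two_pi (h2 j π hπ) (h3 j π hπ)⟩⟩, h1⟩

end IdealTriangulation

end Complex

/-! ### Collapsing structures from an analytic curve of real solutions -/

namespace IdealTriangulation

variable {N : ℕ} {T : IdealTriangulation N}

/-- An analytic curve of real solutions with positive velocity gives hyperbolic structures that
collapse. -/
theorem exists_hyperbolicStructures {z v : Fin N → ℝ}
    (hz : z ∈ T.realDeformationVariety) (hpos : ∀ j, 0 < v j) {c : ℝ → Fin N → ℝ}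
    (hc : AnalyticAt ℝ c 0) (hc0 : c 0 = z) (hcv : HasDerivAt c v 0)
    (hcD : ∀ᶠ s in 𝓝 0, c s ∈ T.realDeformationVariety) :
    ∃ (ζ : ℝ → Fin N → ℂ) (H : Set.Ioi (0 : ℝ) → T.HyperbolicStructure),
      ContDiff ℝ ∞ ζ ∧ (∀ j, ζ 0 j = z j) ∧
      (∀ j, HasDerivAt (fun t => ζ t j) (Complex.I * v j) 0) ∧
      (∀ t : Set.Ioi (0 : ℝ), ζ t ∈ T.thurstonSolutions Complex.arg ∧
        (∀ j, 0 < (ζ t j).im) ∧ (H t).HasShapes (ζ t)) ∧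
      ∀ F : T.TransverselyHyperbolicFoliation, F.HasShapes z →
        CollapsesTo (fun t => (H t).toRealization) F := by
  have hcj : ∀ j, AnalyticAt ℝ (fun s => c s j) 0 := analyticAt_pi_iff.1 hc
  choose C hC hCc using fun j => (hcj j).exists_complexification
  have hC0 : ∀ j, C j 0 = z j := fun j => by
    have := (hCc j).self_of_nhds
    rwa [hc0, Complex.ofReal_zero] at this
  have hC' : ∀ j, HasDerivAt (C j) (v j) 0 := fun j =>
    (hasDerivAt_pi.1 hcv j).complexification (hC j) (hCc j)
  have hsol := eventually_mem_thurstonSolutions_arg hz hpos hcD hC hCc hC0 hC'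
  have han : ∀ᶠ w in 𝓝 0, ∀ j, AnalyticAt ℂ (C j) w :=
    eventually_all.2 fun j => (hC j).eventually_analyticAt
  obtain ⟨δ₁, hδ₁, h₁⟩ := Metric.eventually_nhds_iff.1 han
  obtain ⟨δ₂, hδ₂, h₂⟩ := Metric.eventually_nhds_iff.1 (eventually_nhdsWithin_iff.1 hsol)
  -- `δ₁` keeps `C` analytic along the path, for all real `t`; `δ₂` keeps it among positively
  -- oriented solutions for `t > 0`.
  obtain ⟨η, hη, hη0, hη', hηb, hηpos⟩ := exists_bounded_reparametrization (lt_min hδ₁ hδ₂)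
  have hs : ∀ t : Set.Ioi (0 : ℝ),
      (fun j => C j (Complex.I * η t)) ∈ T.thurstonSolutions Complex.arg ∧
        ∀ j, 0 < (C j (Complex.I * η t)).im := fun t =>
    h₂ (by rw [Real.dist_eq, sub_zero]; exact (hηb t).trans_le (min_le_right _ _)) (hηpos t t.2)
  have hζ : ContDiff ℝ ∞ fun t : ℝ => fun j => C j (Complex.I * η t) := by
    refine contDiff_pi.2 fun j => contDiff_iff_contDiffAt.2 fun t => ?_
    have h1 : AnalyticAt ℂ (C j) (Complex.I * η t) := by
      refine h₁ ?_ j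
      rw [dist_zero_right, norm_mul, Complex.norm_I, one_mul, Complex.norm_real]
      exact (hηb t).trans_le (min_le_left _ _)
    have h2 : ContDiff ℝ ∞ fun t : ℝ => Complex.I * (η t : ℂ) :=
      contDiff_const.mul (Complex.ofRealCLM.contDiff.comp hη)
    exact (h1.contDiffAt.restrict_scalars ℝ).comp t h2.contDiffAt
  have h0 : (fun j => C j (Complex.I * η 0)) = fun j => algebraMap ℝ ℂ (z j) := by
    ext j; simp [hη0, hC0]
  refine ⟨fun t j => C j (Complex.I * η t), fun t =>
    { T.standardRealization (hs t).1 with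
      oriented := fun j => positivelyOriented_standardVertex rfl rfl rfl rfl ((hs t).2 j)
      angle := standardRealization_totalAngle (hs t).1 }, hζ, fun j => congrFun h0 j, ?_,
    fun t => ⟨(hs t).1, (hs t).2, standardRealization_hasShapes (hs t).1⟩, ?_⟩
  · intro j
    have h1 : HasDerivAt (fun t : ℝ => Complex.I * (η t : ℂ)) (Complex.I * ((1 : ℝ) : ℂ)) 0 :=
      hη'.ofReal_comp.const_mul _
    have h2 : HasDerivAt (C j) (v j) (Complex.I * (η 0 : ℂ)) := by simpa [hη0] using hC' j
    exact (h2.comp (0 : ℝ) h1).congr_deriv (by rw [Complex.ofReal_one, mul_one, mul_comm])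
  · intro F hF
    refine collapsesTo_of_tendsto hz (fun r => Complex.conj_ofReal r) (fun t => (hs t).1) ?_ F hF
    rw [← h0]
    exact (hζ.continuous.tendsto 0).comp tendsto_comap

open PseudoComplex in
/-- An analytic curve of real solutions with positive velocity gives AdS structures that
collapse. -/
theorem exists_adSStructures {z v : Fin N → ℝ}
    (hz : z ∈ T.realDeformationVariety) (hpos : ∀ j, 0 < v j) {c : ℝ → Fin N → ℝ}
    (hc : AnalyticAt ℝ c 0) (hc0 : c 0 = z) (hcv : HasDerivAt c v 0)
    (hcD : ∀ᶠ s in 𝓝 0, c s ∈ T.realDeformationVariety) :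
    ∃ (ξ : ℝ → Fin N → PseudoComplex) (A : Set.Ioi (0 : ℝ) → T.AdSStructure),
      ContDiff ℝ ∞ (fun t j => (ξ t j).re) ∧ ContDiff ℝ ∞ (fun t j => (ξ t j).im) ∧
      (∀ j, ξ 0 j = algebraMap ℝ PseudoComplex (z j)) ∧
      (∀ j, HasDerivAt (fun t => (ξ t j).re) 0 0 ∧ HasDerivAt (fun t => (ξ t j).im) (v j) 0) ∧
      (∀ t : Set.Ioi (0 : ℝ), ξ t ∈ T.thurstonSolutions pseudoAngle ∧
        (∀ j, 0 < (ξ t j).im) ∧ (A t).HasShapes (ξ t)) ∧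
      ∀ F : T.TransverselyHyperbolicFoliation, F.HasShapes z →
        CollapsesTo (fun t => (A t).toRealization) F := by
  have hz0 : ∀ j, z j ≠ 0 := fun j => (hz.1 j).1.isUnit.ne_zero
  have hz1 : ∀ j, 1 - z j ≠ 0 := fun j => (hz.1 j).2.isUnit.ne_zero
  have hneg : Tendsto (fun s : ℝ => -s) (𝓝 0) (𝓝 0) := by simpa using continuous_neg.tendsto (0 : ℝ)
  have hcont : ∀ j, Tendsto (fun s => c s j) (𝓝 0) (𝓝 (z j)) := fun j => by
    rw [← hc0]; exact (analyticAt_pi_iff.1 hc j).continuousAt.tendsto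
  have hnear : ∀ᶠ s in 𝓝 (0 : ℝ), AnalyticAt ℝ c s ∧ AnalyticAt ℝ c (-s) ∧
      c s ∈ T.realDeformationVariety ∧ c (-s) ∈ T.realDeformationVariety ∧
      ∀ j, 0 < c s j * c (-s) j ∧ 0 < (1 - c s j) * (1 - c (-s) j) := by
    refine hc.eventually_analyticAt.and ((hneg.eventually hc.eventually_analyticAt).and
      (hcD.and ((hneg.eventually hcD).and (eventually_all.2 fun j => ?_))))
    have h1 := (hcont j).mul ((hcont j).comp hneg)
    have h2 := ((hcont j).const_sub 1).mul (((hcont j).comp hneg).const_sub 1)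
    -- The limits are the squares of `z j` and `1 - z j`, positive since neither vanishes.
    exact (h1.eventually (lt_mem_nhds (mul_self_pos.2 (hz0 j)))).and
      (h2.eventually (lt_mem_nhds (mul_self_pos.2 (hz1 j))))
  have hderiv : ∀ j, HasDerivAt (fun s => c s j) (v j) 0 := hasDerivAt_pi.1 hcv
  have hderiv' : ∀ j, HasDerivAt (fun s => c (-s) j) (-v j) 0 := fun j => by
    have h1 : HasDerivAt (fun s => c s j) (v j) (-(0 : ℝ)) := by simpa using hderiv j
    exact (h1.comp (0 : ℝ) (hasDerivAt_neg (0 : ℝ))).congr_deriv (mul_neg_one _)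
  have him : ∀ᶠ s in 𝓝[>] (0 : ℝ), ∀ j, 0 < (c s j - c (-s) j) / 2 := by
    refine eventually_all.2 fun j => HasDerivAt.eventually_pos (v := v j) ?_ (by simp) (hpos j)
    exact (((hderiv j).sub (hderiv' j)).div_const 2).congr_deriv (by ring)
  obtain ⟨δ₁, hδ₁, h₁⟩ := Metric.eventually_nhds_iff.1 hnear
  obtain ⟨δ₂, hδ₂, h₂⟩ := Metric.eventually_nhds_iff.1 (eventually_nhdsWithin_iff.1 him)
  obtain ⟨η, hη, hη0, hη', hηb, hηpos⟩ := exists_bounded_reparametrization (lt_min hδ₁ hδ₂)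
  have hn : ∀ t, _ := fun t =>
    h₁ (y := η t) (by rw [Real.dist_eq, sub_zero]; exact (hηb t).trans_le (min_le_left _ _))
  have hp : ∀ t : Set.Ioi (0 : ℝ), ∀ j, 0 < (c (η t) j - c (-η t) j) / 2 := fun t =>
    h₂ (by rw [Real.dist_eq, sub_zero]; exact (hηb t).trans_le (min_le_right _ _)) (hηpos t t.2)
  -- The pair stands for `c` at `τ η t`: its real part is the even part of `c` and its imaginary
  -- part the odd part, whence the velocity `τ v`.
  have hs : ∀ t, (fun j => ofPair (c (η t) j) (c (-η t) j)) ∈ T.thurstonSolutions pseudoAngle :=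
    fun t => ofPair_mem_thurstonSolutions (hn t).2.2.1 (hn t).2.2.2.1
      (fun j => ((hn t).2.2.2.2 j).1) (fun j => ((hn t).2.2.2.2 j).2)
  have hl : ContDiff ℝ ∞ fun t => c (η t) := contDiff_iff_contDiffAt.2 fun t =>
    (hn t).1.contDiffAt.comp t hη.contDiffAt
  have hr : ContDiff ℝ ∞ fun t => c (-η t) := contDiff_iff_contDiffAt.2 fun t =>
    ContDiffAt.comp t (hn t).2.1.contDiffAt hη.contDiffAt.neg
  have hre : ContDiff ℝ ∞ fun t j => (ofPair (c (η t) j) (c (-η t) j)).re :=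
    contDiff_pi.2 fun j => ((contDiff_pi.1 hl j).add (contDiff_pi.1 hr j)).div_const 2
  have him' : ContDiff ℝ ∞ fun t j => (ofPair (c (η t) j) (c (-η t) j)).im :=
    contDiff_pi.2 fun j => ((contDiff_pi.1 hl j).sub (contDiff_pi.1 hr j)).div_const 2
  have h0 : (fun j => ofPair (c (η 0) j) (c (-η 0) j)) =
      fun j => algebraMap ℝ PseudoComplex (z j) := by
    ext j <;> simp [ofPair, hη0, hc0]
  have dl : ∀ j, HasDerivAt (fun t => c (η t) j) (v j) 0 := fun j => by
    have h1 : HasDerivAt (fun s => c s j) (v j) (η 0) := by rw [hη0]; exact hderiv j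
    exact (h1.comp (0 : ℝ) hη').congr_deriv (mul_one _)
  have dr : ∀ j, HasDerivAt (fun t => c (-η t) j) (-v j) 0 := fun j => by
    have h1 : HasDerivAt (fun s => c (-s) j) (-v j) (η 0) := by rw [hη0]; exact hderiv' j
    exact (h1.comp (0 : ℝ) hη').congr_deriv (mul_one _)
  refine ⟨fun t j => ofPair (c (η t) j) (c (-η t) j), fun t =>
    { T.standardRealization (hs t) with
      oriented := fun j => positivelyOriented_standardVertex rfl rfl rfl rfl (hp t j)
      angle := standardRealization_totalAngle (hs t) }, hre, him', fun j => congrFun h0 j,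
    fun j => ⟨?_, ?_⟩, fun t => ⟨hs t, hp t, standardRealization_hasShapes (hs t)⟩, ?_⟩
  · exact (((dl j).add (dr j)).div_const 2).congr_deriv (by ring)
  · exact (((dl j).sub (dr j)).div_const 2).congr_deriv (by ring)
  · intro F hF
    refine collapsesTo_of_tendsto hz (fun r => ?_) (fun t => hs t) ?_ F hF
    · refine QuadraticAlgebra.ext ?_ ?_ <;> simp
    · rw [← h0]
      have hcontinuous : Continuous fun (t : ℝ) (j : Fin N) =>
          ofPair (c (η t) j) (c (-η t) j) := by
        refine continuous_pi fun j => continuous_induced_rng.2 ?_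
        exact (contDiff_pi.1 hre j).continuous.prodMk (contDiff_pi.1 him' j).continuous
      exact (hcontinuous.tendsto 0).comp tendsto_comap

end IdealTriangulation

end

theorem proposition5p1 {N : ℕ} (T : IdealTriangulation N) (z v : Fin N → ℝ)
    (hz : z ∈ T.realDeformationVariety)
    (hsmooth : IsSmoothPoint T.realDeformationVariety z)
    (hv : IsTangentVector T.realDeformationVariety z v) (hpos : ∀ j, 0 < v j) :
    (∃ F : T.TransverselyHyperbolicFoliation, F.HasShapes z) ∧
    (∃ (ζ : ℝ → Fin N → ℂ) (H : Set.Ioi (0 : ℝ) → T.HyperbolicStructure),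
      ContDiff ℝ ∞ ζ ∧ (∀ j, ζ 0 j = z j) ∧
      (∀ j, HasDerivAt (fun t => ζ t j) (Complex.I * v j) 0) ∧
      (∀ t : Set.Ioi (0 : ℝ), ζ t ∈ T.thurstonSolutions Complex.arg ∧
        (∀ j, 0 < (ζ t j).im) ∧ (H t).HasShapes (ζ t)) ∧
      ∀ F : T.TransverselyHyperbolicFoliation, F.HasShapes z →
        IdealTriangulation.CollapsesTo (fun t => (H t).toRealization) F) ∧
    (∃ (ξ : ℝ → Fin N → PseudoComplex) (A : Set.Ioi (0 : ℝ) → T.AdSStructure),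
      ContDiff ℝ ∞ (fun t j => (ξ t j).re) ∧ ContDiff ℝ ∞ (fun t j => (ξ t j).im) ∧
      (∀ j, ξ 0 j = algebraMap ℝ PseudoComplex (z j)) ∧
      (∀ j, HasDerivAt (fun t => (ξ t j).re) 0 0 ∧ HasDerivAt (fun t => (ξ t j).im) (v j) 0) ∧
      (∀ t : Set.Ioi (0 : ℝ), ξ t ∈ T.thurstonSolutions pseudoAngle ∧
        (∀ j, 0 < (ξ t j).im) ∧ (A t).HasShapes (ξ t)) ∧
      ∀ F : T.TransverselyHyperbolicFoliation, F.HasShapes z →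
        IdealTriangulation.CollapsesTo (fun t => (A t).toRealization) F) := by
  obtain ⟨c, hc, hc0, hcv, hcD⟩ := hsmooth.exists_analytic_curve hv
  exact ⟨⟨{ T.standardRealization hz with
      angle := IdealTriangulation.standardRealization_totalAngle hz },
      IdealTriangulation.standardRealization_hasShapes hz⟩,
    IdealTriangulation.exists_hyperbolicStructures hz hpos hc hc0 hcv hcD,
    IdealTriangulation.exists_adSStructures hz hpos hc hc0 hcv hcD⟩
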